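/- **Setting.** Let $d\in\{2,3\}$ and let $\Omega\subset\mathbb R^d$ be a bounded, connected, open set with Lipschitz boundary $\Gamma=\partial\Omega$. Let $\mathcal T_h$ be a (conforming, finite) simplicial partition of $\Omega$, let $h_T$ be the diameter of $T\in\mathcal T_h$, and let $\mathcal E_h$ be the set of all edges ($d=2$) or faces ($d=3$) of the partition. Let $k\ge 1$ be an integer, $\mu,\lambda>0$, $\mathbf f\in[L^2(\Omega)]^d$ and $\widehat{\mathbf g}\in[L^2(\Gamma)]^d$. Write $(\cdot,\cdot)_T$, $\langle\cdot,\cdot\rangle_{\partial T}$ and $(\cdot,\cdot)$ for the $L^2$ inner products on $T$, $\partial T$ and $\Omega$, $P_j$ for polynomials of degree at most $j$, and $\mathbf n$ for the unit outward normal on $\partial T$. Define $$V_h=\{\mathbf v=\{\mathbf v_0,\mathbf v_b\}:\ \mathbf v_0|_T\in[P_k(T)]^d,\ \mathbf v_b|_e\in[P_k(e)]^d,\ T\in\mathcal T_h,\ e\in\mathcal E_h\},\qquad V_h^0=\{\mathbf v\in V_h:\ \mathbf v_b=\mathbf 0\text{ on }\Gamma\}.$$ For $\mathbf v\in V_h$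 and $T\in\mathcal T_h$, the weak gradient $\nabla_w\mathbf v|_T\in[P_{k-1}(T)]^{d\times d}$ and the weak divergence $\nabla_w\cdot\mathbf v|_T\in P_k(T)$ are defined by $$(\nabla_w\mathbf v,\varphi)_T=-(\mathbf v_0,\nabla\cdot\varphi)_T+\langle\mathbf v_b,\varphi\mathbf n\rangle_{\partial T}\quad\forall\varphi\in[P_{k-1}(T)]^{d\times d},$$ $$(\nabla_w\cdot\mathbf v,\phi)_T=-(\mathbf v_0,\nabla\phi)_T+\langle\mathbf v_b\cdot\mathbf n,\phi\rangle_{\partial T}\quad\forall\phi\in P_k(T).$$ With $RT_k(T)=[P_k(T)]^d+\mathbf x P_k(T)$, the reconstruction $\mathbf R_T(\mathbf v)\in H(\mathrm{div};\Omega)$ is defined by $\mathbf R_T(\mathbf v)|_T\in RT_k(T)$ for all $T\in\mathcal T_h$ and $$\int_T\mathbf R_T(\mathbf v)\cdot\mathbf w\,dT=\int_T\mathbf v_0\cdot\mathbf w\,dT\quad\forall\mathbf w\in[P_{k-1}(T)]^d,\qquad \int_e\mathbf R_T(\mathbf v)\cdot\mathbf n\,\phi\,ds=\int_e\mathbf v_b\cdot\mathbf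 n\,\phi\,ds\quad\forall\phi\in P_k(e),\ e\subset\partial T.$$ Let $$\mathcal A_h^s(\mathbf w,\mathbf v)=\mu\sum_{T}(\nabla_w\mathbf w,\nabla_w\mathbf v)_T+(\lambda+\mu)\sum_T(\nabla_w\cdot\mathbf w,\nabla_w\cdot\mathbf v)_T+\sum_T h_T^{-1}\langle\mathbf w_0-\mathbf w_b,\mathbf v_0-\mathbf v_b\rangle_{\partial T},$$ and let $Q_b$ be the $L^2(e)$ orthogonal projection onto $[P_k(e)]^d$ on each $e\in\mathcal E_h$. **Theorem.** The weak gradient, the weak divergence and the reconstruction $\mathbf R_T(\mathbf v)$ are well defined (each exists and is unique) for every $\mathbf v\in V_h$, and there is exactly one $\mathbf u_h=\{\mathbf u_0,\mathbf u_b\}\in V_h$ such that $\mathbf u_b=Q_b\widehat{\mathbf g}$ on $\Gamma$ and $$\mathcal A_h^s(\mathbf u_h,\mathbf v)=(\mathbf f,\mathbf R_T(\mathbf v))\qquad\forall\,\mathbf v\in V_h^0.$$ -/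

import Mathlib

open MeasureTheory
open scoped RealInnerProductSpace ContDiff

noncomputable section

namespace WG

/-- `ℝᵈ` with the Euclidean inner product. -/
abbrev Pt (d : ℕ) : Type := EuclideanSpace ℝ (Fin d)

variable {d : ℕ}

/-! ### The domain and its partition -/

/-- Near each boundary point, for a suitable unit vector `ν`, the set `Ω` is the set of points
lying strictly above the graph of a Lipschitz function of the coordinates orthogonal to `ν`. -/
def HasLipschitzBoundary (Ω : Set (Pt d)) : Prop :=
  ∀ x ∈ frontier Ω, ∃ r > 0, ∃ ν : Pt d, ‖ν‖ = 1 ∧ ∃ (γ : Pt d → ℝ) (L : NNReal),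
    LipschitzWith L γ ∧
      ∀ y ∈ Metric.ball x r, (y ∈ Ω ↔ γ (y - ⟪ν, y⟫ • ν) < ⟪ν, y⟫)

/-- A (conforming) simplicial partition of `Ω`: a finite simplicial complex, each of whose
simplices is a face of a `d`-simplex of the complex, and whose simplices cover exactly the
closure of `Ω`. Simplices are given by their vertex sets. -/
structure SimplicialPartition (Ω : Set (Pt d)) extends
    Geometry.SimplicialComplex ℝ (Pt d) where
  finite_faces : faces.Finite
  exists_cell : ∀ s ∈ faces, ∃ T ∈ faces, s ⊆ T ∧ T.card = d + 1
  cover : (⋃ s ∈ faces, convexHull ℝ (s : Set (Pt d))) = closure Ω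

variable {Ω : Set (Pt d)}

/-- The elements `T ∈ 𝒯_h`. -/
abbrev SimplicialPartition.Cell (𝒯 : SimplicialPartition Ω) : Type :=
  {T : Finset (Pt d) // T ∈ 𝒯.faces ∧ T.card = d + 1}

/-- The edges (`d = 2`) or faces (`d = 3`) `e ∈ ℰ_h`. -/
abbrev SimplicialPartition.Face (𝒯 : SimplicialPartition Ω) : Type :=
  {e : Finset (Pt d) // e ∈ 𝒯.faces ∧ e.card = d}

instance (𝒯 : SimplicialPartition Ω) : Fintype 𝒯.Cell :=
  (𝒯.finite_faces.subset (fun _ h => h.1 :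
    {T : Finset (Pt d) | T ∈ 𝒯.faces ∧ T.card = d + 1} ⊆ 𝒯.faces)).fintype

instance (𝒯 : SimplicialPartition Ω) : Fintype 𝒯.Face :=
  (𝒯.finite_faces.subset (fun _ h => h.1 :
    {e : Finset (Pt d) | e ∈ 𝒯.faces ∧ e.card = d} ⊆ 𝒯.faces)).fintype

/-- The closed simplex with vertex set `s`. -/
abbrev hull (s : Finset (Pt d)) : Set (Pt d) := convexHull ℝ (s : Set (Pt d))

open Classical in
/-- The edges or faces `e ⊂ ∂T`. -/
def SimplicialPartition.sides (𝒯 : SimplicialPartition Ω) (T : 𝒯.Cell) : Finset 𝒯.Face :=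
  Finset.univ.filter fun e => e.1 ⊆ T.1

/-- `h_T`, the diameter of `T`. -/
def diamT (T : Finset (Pt d)) : ℝ := Metric.diam (hull T)

/-- The unit outward normal of the simplex `T` on its side `e`: the normalized component
orthogonal to `e` of the vector from the barycenter of `T` to the barycenter of `e`. -/
def outwardNormal (T e : Finset (Pt d)) : Pt d :=
  let m : Pt d := (vectorSpan ℝ (e : Set (Pt d)))ᗮ.starProjection
    (e.centroid ℝ id - T.centroid ℝ id)
  ‖m‖⁻¹ • m

/-- The `(d-1)`-dimensional surface measure on `e`, on which `∫_e ⬝ ds` is based. -/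
def surf (e : Finset (Pt d)) : Measure (hull e) := Measure.euclideanHausdorffMeasure (d - 1)

/-! ### Polynomials -/

/-- The value at `x` of a polynomial in `d` variables. -/
def pval (p : MvPolynomial (Fin d) ℝ) (x : Pt d) : ℝ := MvPolynomial.eval (fun i => x i) p

variable (d) in
/-- Polynomials in `d` variables of total degree at most `k`. As a `d`-simplex `T` has interior
points, this is also `P_k(T)`. -/
abbrev Poly (k : ℕ) : Submodule ℝ (MvPolynomial (Fin d) ℝ) :=
  MvPolynomial.restrictTotalDegree (Fin d) ℝ k

/-- Restriction of polynomials to `S`, as functions. -/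
def restrictPoly (S : Set (Pt d)) : MvPolynomial (Fin d) ℝ →ₗ[ℝ] (S → ℝ) :=
  LinearMap.pi fun x => (MvPolynomial.aeval (fun i => (x : Pt d) i)).toLinearMap

/-- `P_k(e)`: the functions on `e` that are restrictions of polynomials of degree at most `k`. -/
abbrev FacePoly (k : ℕ) (e : Finset (Pt d)) : Submodule ℝ (hull e → ℝ) :=
  (Poly d k).map (restrictPoly (hull e))

variable (d) in
/-- The Raviart--Thomas space `RT_k(T) = [P_k(T)]^d + x P_k(T)`. -/
def RT (k : ℕ) : Submodule ℝ (Fin d → MvPolynomial (Fin d) ℝ) :=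
  Submodule.pi Set.univ (fun _ => Poly d k) ⊔
    (Poly d k).map (LinearMap.pi fun i => LinearMap.mulLeft ℝ (MvPolynomial.X i))

/-! ### The weak finite element space -/

/-- `V_h`: the pairs `v = {v₀, v_b}` with `v₀|_T ∈ [P_k(T)]^d` for every element `T` and
`v_b|_e ∈ [P_k(e)]^d` (single-valued) for every edge or face `e`. -/
abbrev WeakSpace (𝒯 : SimplicialPartition Ω) (k : ℕ) : Type :=
  (𝒯.Cell → Fin d → Poly d k) × ((e : 𝒯.Face) → Fin d → FacePoly k e.1)

variable {𝒯 : SimplicialPartition Ω} {k : ℕ}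

/-- `e` lies on `Γ = ∂Ω`. -/
def OnBoundary (Ω : Set (Pt d)) (e : Finset (Pt d)) : Prop := hull e ⊆ frontier Ω

/-- `v ∈ V_h⁰`, that is, `v_b = 0` on `Γ`. -/
def MemV0 (v : WeakSpace 𝒯 k) : Prop := ∀ e : 𝒯.Face, OnBoundary Ω e.1 → v.2 e = 0

/-! ### Weak gradient and weak divergence -/

/-- `G` is the weak gradient of `v` on `T`:
`(G, φ)_T = -(v₀, ∇·φ)_T + ⟨v_b, φ n⟩_{∂T}` for all `φ ∈ [P_{k-1}(T)]^{d×d}`. -/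
def IsWeakGrad (v : WeakSpace 𝒯 k) (T : 𝒯.Cell) (G : Matrix (Fin d) (Fin d) (Poly d (k - 1))) :
    Prop :=
  ∀ φ : Matrix (Fin d) (Fin d) (Poly d (k - 1)),
    ∫ x in hull T.1, ∑ i, ∑ j, pval (G i j).1 x * pval (φ i j).1 x =
      - (∫ x in hull T.1, ∑ i, pval (v.1 T i).1 x *
            ∑ j, pval (MvPolynomial.pderiv j (φ i j).1) x)
      + ∑ e ∈ 𝒯.sides T, ∫ x : hull e.1,
          ∑ i, (v.2 e i).1 x * ∑ j, pval (φ i j).1 x * outwardNormal T.1 e.1 j ∂(surf e.1)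

/-- `D` is the weak divergence of `v` on `T`:
`(D, φ)_T = -(v₀, ∇φ)_T + ⟨v_b · n, φ⟩_{∂T}` for all `φ ∈ P_k(T)`. -/
def IsWeakDiv (v : WeakSpace 𝒯 k) (T : 𝒯.Cell) (D : Poly d k) : Prop :=
  ∀ φ : Poly d k,
    ∫ x in hull T.1, pval D.1 x * pval φ.1 x =
      - (∫ x in hull T.1, ∑ i, pval (v.1 T i).1 x * pval (MvPolynomial.pderiv i φ.1) x)
      + ∑ e ∈ 𝒯.sides T, ∫ x : hull e.1,
          (∑ i, (v.2 e i).1 x * outwardNormal T.1 e.1 i) * pval φ.1 x ∂(surf e.1)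

/-- `∇_w v` on `T`. -/
def weakGrad (v : WeakSpace 𝒯 k) (T : 𝒯.Cell) : Matrix (Fin d) (Fin d) (Poly d (k - 1)) :=
  Classical.epsilon (IsWeakGrad v T)

/-- `∇_w · v` on `T`. -/
def weakDiv (v : WeakSpace 𝒯 k) (T : 𝒯.Cell) : Poly d k :=
  Classical.epsilon (IsWeakDiv v T)

/-! ### The reconstruction operator -/

/-- `w ∈ H(div; Ω)`: both `w` and its distributional divergence `q` are in `L²(Ω)`. Here
`fderiv ℝ φ x (w x)` is `w · ∇φ` at `x`. -/
def MemHDiv (Ω : Set (Pt d)) (w : Pt d → Pt d) : Prop :=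
  MemLp w 2 (volume.restrict Ω) ∧
    ∃ q : Pt d → ℝ, MemLp q 2 (volume.restrict Ω) ∧
      ∀ φ : Pt d → ℝ, ContDiff ℝ ∞ φ → HasCompactSupport φ → tsupport φ ⊆ Ω →
        ∫ x in Ω, fderiv ℝ φ x (w x) = - ∫ x in Ω, q x * φ x

variable (𝒯 k) in
/-- The fields whose restriction to each element `T` is in `RT_k(T)`. -/
abbrev BrokenRT : Type := 𝒯.Cell → RT d k

/-- The (almost everywhere defined) function on `Ω` given by such a field: it equals `r_T` in the
interior of every element `T`, and (by convention) zero on the remaining null set. -/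
def BrokenRT.toFun (r : BrokenRT 𝒯 k) (x : Pt d) : Pt d :=
  WithLp.toLp 2 fun i => ∑ T : 𝒯.Cell, (interior (hull T.1)).indicator (pval ((r T).1 i)) x

/-- `r` is the reconstruction of `v`: it is in `H(div; Ω)`, in `RT_k(T)` on every `T`, and has the
same moments as `v₀` against `[P_{k-1}(T)]^d`, and its normal component has the same moments
as that of `v_b` against `P_k(e)` for every `e ⊂ ∂T`. -/
structure IsReconstruction (v : WeakSpace 𝒯 k) (r : BrokenRT 𝒯 k) : Prop where
  memHDiv : MemHDiv Ω r.toFun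
  interior_moments : ∀ (T : 𝒯.Cell) (w : Fin d → Poly d (k - 1)),
    ∫ x in hull T.1, ∑ i, pval ((r T).1 i) x * pval (w i).1 x =
      ∫ x in hull T.1, ∑ i, pval (v.1 T i).1 x * pval (w i).1 x
  side_moments : ∀ (T : 𝒯.Cell), ∀ e ∈ 𝒯.sides T, ∀ φ : FacePoly k e.1,
    ∫ x : hull e.1, (∑ i, pval ((r T).1 i) x * outwardNormal T.1 e.1 i) * φ.1 x ∂(surf e.1) =
      ∫ x : hull e.1, (∑ i, (v.2 e i).1 x * outwardNormal T.1 e.1 i) * φ.1 x ∂(surf e.1)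

/-- The reconstruction `R_T(v)`. -/
def reconstruct (v : WeakSpace 𝒯 k) : BrokenRT 𝒯 k :=
  Classical.epsilon (IsReconstruction v)

/-! ### The scheme -/

/-- The stabilizer `S_h(w, v)`. -/
def stab (w v : WeakSpace 𝒯 k) : ℝ :=
  ∑ T : 𝒯.Cell, (diamT T.1)⁻¹ * ∑ e ∈ 𝒯.sides T, ∫ x : hull e.1,
    ∑ i, (pval (w.1 T i).1 x - (w.2 e i).1 x) * (pval (v.1 T i).1 x - (v.2 e i).1 x) ∂(surf e.1)

/-- The bilinear form `A_h(w, v)`. -/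
def formA (lam mu : ℝ) (w v : WeakSpace 𝒯 k) : ℝ :=
  mu * (∑ T : 𝒯.Cell, ∫ x in hull T.1,
      ∑ i, ∑ j, pval (weakGrad w T i j).1 x * pval (weakGrad v T i j).1 x)
    + (lam + mu) * (∑ T : 𝒯.Cell, ∫ x in hull T.1,
      pval (weakDiv w T).1 x * pval (weakDiv v T).1 x)

/-- The stabilized form `A_h^s(w, v)`. -/
def formAs (lam mu : ℝ) (w v : WeakSpace 𝒯 k) : ℝ := formA lam mu w v + stab w v

/-- `p` is `Q_b g` on `e`, the `L²(e)` orthogonal projection of `g|_e` onto `[P_k(e)]^d`. -/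
def IsQb (g : Pt d → Pt d) {e : Finset (Pt d)} (p : Fin d → FacePoly k e) : Prop :=
  ∀ q : Fin d → FacePoly k e,
    ∫ x : hull e, ∑ i, (p i).1 x * (q i).1 x ∂(surf e) =
      ∫ x : hull e, ∑ i, g x i * (q i).1 x ∂(surf e)

/-- `u` solves the scheme: `u_b = Q_b g` on `Γ`, and
`A_h^s(u, v) = (f, R_T(v))` for all `v ∈ V_h⁰`. -/
structure IsSolution (lam mu : ℝ) (f g : Pt d → Pt d) (u : WeakSpace 𝒯 k) : Prop where
  boundary : ∀ e : 𝒯.Face, OnBoundary Ω e.1 → IsQb g (u.2 e)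
  equation : ∀ v : WeakSpace 𝒯 k, MemV0 v →
    formAs lam mu u v = ∫ x in Ω, ⟪f x, (reconstruct v).toFun x⟫

end WG

end

noncomputable section

/-! ### Geometry of simplices -/

namespace WG

variable {d : ℕ}

/-! All the objects are finite-dimensional, so each existence claim reduces to a uniqueness claim.
The weak gradient and weak divergence are Riesz representatives of linear functionals for the
`L²(T)` inner product, which is definite on polynomials because a simplex has interior points
(`rieszEquiv`).

The reconstruction is cellwise the inverse of the Raviart–Thomas degrees of freedom. They are
injective (`eq_zero_of_moments`): if all moments of `r` vanish, the component of `r` along `∇λ_a` is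
`λ_a ψ_a`, and a suitable test field turns the interior moments into `∫ ∑ λ_a ψ_a² = 0`. They are
onto by a dimension count (`le_finrank_RT`, `finrank_facePoly_le`). Membership in `H(div)` then
follows from the moments: `v_b` is single-valued, so the normal traces from the two cells at an
interior face cancel (`dotTrace_add_eq_zero`), and integration by parts on each cell gives the
distributional divergence (`memHDiv_of_hasMoments`). This rests on the divergence theorem on a
simplex (`integral_fderiv`) and on the fact that an interior face has exactly two cells, with
opposite normals (`exists_pair`).

For the scheme, the form is definite on `V_h⁰` (`formB_definite`). If `A(v, v) = 0`, the weak
gradient and the jumps `v₀ - v_b` vanish, so `v₀` is constant on each cell, agrees across interior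
faces and is zero on cells with a boundary face; by `cellConst_eq_zero` it is zero everywhere. A
definite form on a finite-dimensional space gives one solution in each coset of `V_h⁰`, and the
boundary condition selects such a coset (`existsUnique_sub_mem`). -/

/-- `T` is the vertex set of a nondegenerate `d`-simplex. -/
structure IsSimplex (T : Finset (Pt d)) : Prop where
  indep : AffineIndependent ℝ ((↑) : T → Pt d)
  card : T.card = d + 1

namespace IsSimplex

variable {T : Finset (Pt d)} (h : IsSimplex T)
include h

/-- The vertices as an affine basis. -/
def basis : AffineBasis T ℝ (Pt d) where
  toFun := (↑)
  ind' := h.indep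
  tot' := by
    rw [h.indep.affineSpan_eq_top_iff_card_eq_finrank_add_one]
    simp [h.card]

@[simp] lemma basis_apply (a : T) : h.basis a = (a : Pt d) := rfl

lemma range_basis : Set.range h.basis = (T : Set (Pt d)) := by
  ext x
  simp [Set.mem_range]

/-- The barycentric coordinate with respect to the vertex `a`. -/
def lam (a : T) (x : Pt d) : ℝ := h.basis.coord a x

/-- The gradient of a barycentric coordinate. -/
def grad (a : T) : Pt d :=
  (InnerProductSpace.toDual ℝ (Pt d)).symm (LinearMap.toContinuousLinearMap (h.basis.coord a).linear)

lemma inner_grad (a : T) (z : Pt d) : ⟪h.grad a, z⟫ = (h.basis.coord a).linear z := by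
  simp [grad]

lemma lam_sub (a : T) (x y : Pt d) : h.lam a x - h.lam a y = ⟪h.grad a, x - y⟫ := by
  rw [inner_grad, lam, lam]
  exact ((h.basis.coord a).linearMap_vsub x y).symm

lemma lam_eq (a : T) (x y : Pt d) : h.lam a x = h.lam a y + ⟪h.grad a, x - y⟫ := by
  rw [← h.lam_sub]; ring

open Classical in
lemma lam_vertex (a b : T) : h.lam a b = if a = b then 1 else 0 := by
  have := h.basis.coord_apply a b
  simpa [lam] using this

lemma sum_lam (x : Pt d) : ∑ a, h.lam a x = 1 := h.basis.sum_coord_apply_eq_one x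

lemma sum_lam_smul (x : Pt d) : ∑ a, h.lam a x • (a : Pt d) = x :=
  h.basis.linear_combination_coord_eq_self x

lemma continuous_lam (a : T) : Continuous (h.lam a) := continuous_barycentric_coord h.basis a

lemma sum_grad : ∑ a, h.grad a = 0 := by
  refine ext_inner_right ℝ fun z => ?_
  have h1 := h.sum_lam z
  have h0 := h.sum_lam 0
  have : ∑ a, (h.lam a z - h.lam a 0) = 0 := by rw [Finset.sum_sub_distrib, h1, h0, sub_self]
  rw [sum_inner, inner_zero_left, ← this]
  exact Finset.sum_congr rfl fun a _ => by rw [h.lam_sub, sub_zero]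

lemma sum_inner_grad_smul (z : Pt d) : ∑ a, ⟪h.grad a, z⟫ • (a : Pt d) = z := by
  have h1 := h.sum_lam_smul z
  have h0 := h.sum_lam_smul 0
  calc _ = ∑ a, (h.lam a z • (a : Pt d) - h.lam a 0 • (a : Pt d)) :=
        Finset.sum_congr rfl fun a _ => by rw [← sub_smul, h.lam_sub, sub_zero]
    _ = z := by rw [Finset.sum_sub_distrib, h1, h0, sub_zero]

lemma mem_hull {x : Pt d} : x ∈ hull T ↔ ∀ a, 0 ≤ h.lam a x := by
  have := h.basis.convexHull_eq_nonneg_coord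
  rw [range_basis] at this
  rw [hull, this]; rfl

lemma mem_interior {x : Pt d} : x ∈ interior (hull T) ↔ ∀ a, 0 < h.lam a x := by
  have := h.basis.interior_convexHull
  rw [range_basis] at this
  rw [hull, this]; rfl

/-- The zero set of `λ_a` is convex and contains every vertex other than `a`. Conversely, a point
whose other coordinates vanish is, by its own barycentric expansion, a convex combination of `s`. -/
lemma mem_hull_of_subset {s : Finset (Pt d)} (hs : s ⊆ T) {x : Pt d} :
    x ∈ hull s ↔ x ∈ hull T ∧ ∀ a : T, (a : Pt d) ∉ s → h.lam a x = 0 := by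
  constructor
  · intro hx
    refine ⟨convexHull_mono (by exact_mod_cast hs) hx, fun a ha => ?_⟩
    have hc : Convex ℝ {y : Pt d | h.lam a y = 0} := by
      have := (convex_singleton (𝕜 := ℝ) (0 : ℝ)).affine_preimage (h.basis.coord a)
      exact this
    refine convexHull_min (fun y hy => ?_) hc hx
    have hyT : y ∈ T := hs hy
    have := h.lam_vertex a ⟨y, hyT⟩
    rw [if_neg (by rintro rfl; exact ha hy)] at this
    exact this
  · rintro ⟨hx, h0⟩
    rw [h.mem_hull] at hx
    have key : ∑ a ∈ Finset.univ.filter (fun a : T => (a : Pt d) ∈ s), h.lam a x • (a : Pt d) = x := by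
      rw [Finset.sum_filter_of_ne, h.sum_lam_smul]
      intro a _ hne
      by_contra hh
      exact hne (by rw [h0 a hh, zero_smul])
    rw [← key]
    refine (convex_convexHull ℝ _).sum_mem (fun a _ => hx a) ?_ ?_
    · rw [Finset.sum_filter_of_ne, h.sum_lam]
      intro a _ hne
      by_contra hh
      exact hne (h0 a hh)
    · intro a ha
      exact subset_convexHull ℝ _ (by simpa using ha)

open Classical in
lemma mem_hull_erase {a : T} {x : Pt d} :
    x ∈ hull (T.erase a) ↔ x ∈ hull T ∧ h.lam a x = 0 := by
  rw [h.mem_hull_of_subset (Finset.erase_subset _ _)]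
  refine and_congr_right fun _ => ⟨fun hh => hh a (by simp), fun hh b hb => ?_⟩
  have : b = a := by
    by_contra hne
    exact hb (Finset.mem_erase.2 ⟨fun hba => hne (Subtype.ext hba), b.2⟩)
  rw [this, hh]

lemma lam_centroid_of_notMem {s : Finset (Pt d)} (hs : s ⊆ T) (hne : s.Nonempty) (a : T)
    (ha : (a : Pt d) ∉ s) : h.lam a (s.centroid ℝ id) = 0 := by
  have : s.centroid ℝ id ∈ hull s := Finset.centroid_mem_convexHull (R := ℝ) s hne
  exact ((h.mem_hull_of_subset hs).1 this).2 a ha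

lemma lam_centroid {s : Finset (Pt d)} (hs : s ⊆ T) (a : T)
    (ha : (a : Pt d) ∈ s) : h.lam a (s.centroid ℝ id) = (s.card : ℝ)⁻¹ := by
  classical
  have hw : ∑ i ∈ s, s.centroidWeights ℝ i = 1 :=
    s.sum_centroidWeights_eq_one_of_nonempty ℝ ⟨a, ha⟩
  rw [lam, Finset.centroid_def, Finset.map_affineCombination _ _ _ hw,
    Finset.affineCombination_eq_linear_combination _ _ _ hw]
  rw [Finset.sum_eq_single (a : Pt d)]
  · have := h.lam_vertex a a
    simp only [lam, if_true] at this
    simp [this]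
  · intro b hb hba
    have := h.lam_vertex a ⟨b, hs hb⟩
    rw [if_neg (by rintro rfl; exact hba rfl)] at this
    simp only [lam] at this
    simp [this]
  · intro hh; exact absurd ha hh

lemma centroid_mem_interior : T.centroid ℝ id ∈ interior (hull T) := by
  rw [h.mem_interior]
  intro a
  rw [h.lam_centroid subset_rfl a a.2, h.card]
  positivity

lemma nonempty_of_pos (hd : 0 < d) (a : T) [DecidableEq (Pt d)] : (T.erase a).Nonempty := by
  rw [← Finset.card_pos, Finset.card_erase_of_mem a.2, h.card]
  omega

lemma grad_ne_zero (hd : 0 < d) (a : T) : h.grad a ≠ 0 := by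
  classical
  obtain ⟨b, hb⟩ := h.nonempty_of_pos hd a
  obtain ⟨hb1, hb2⟩ := Finset.mem_erase.1 hb
  intro h0
  have := h.lam_sub a a b
  rw [h0, inner_zero_left, h.lam_vertex, h.lam_vertex a ⟨b, hb2⟩, if_pos rfl,
    if_neg (by rintro rfl; exact hb1 rfl)] at this
  norm_num at this

lemma norm_grad_pos (hd : 0 < d) (a : T) : 0 < ‖h.grad a‖ := norm_pos_iff.2 (h.grad_ne_zero hd a)

-- `λ_a` vanishes at every vertex of the side, which gives one inclusion; both spaces have dimension
-- `d - 1`.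
open Classical in
lemma vectorSpan_erase (hd : 0 < d) (a : T) :
    vectorSpan ℝ ((T.erase a : Finset (Pt d)) : Set (Pt d)) = (ℝ ∙ h.grad a)ᗮ := by
  have hcard : (T.erase (a : Pt d)).card = (d - 1) + 1 := by
    rw [Finset.card_erase_of_mem a.2, h.card]; omega
  have hind : AffineIndependent ℝ ((↑) : (T.erase (a : Pt d)) → Pt d) :=
    h.indep.mono (s := ((T.erase (a : Pt d) : Finset (Pt d)) : Set (Pt d)))
      (t := (T : Set (Pt d))) (by exact_mod_cast Finset.erase_subset _ _)
  have hr : Set.range ((↑) : (T.erase (a : Pt d)) → Pt d)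
      = ((T.erase a : Finset (Pt d)) : Set (Pt d)) := Subtype.range_coe
  have hf : Module.finrank ℝ (ℝ ∙ h.grad a)ᗮ = d - 1 := by
    have h1 := (ℝ ∙ h.grad a).finrank_add_finrank_orthogonal
    rw [finrank_span_singleton (h.grad_ne_zero hd a), finrank_euclideanSpace_fin] at h1
    omega
  have := hind.vectorSpan_eq_of_le_of_card_eq_finrank_add_one (sm := (ℝ ∙ h.grad a)ᗮ) ?_ ?_
  · rwa [hr] at this
  · rw [hr, vectorSpan, Submodule.span_le]
    rintro _ ⟨x, hx, y, hy, rfl⟩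
    rw [SetLike.mem_coe, Submodule.mem_orthogonal_singleton_iff_inner_right]
    have aux : ∀ z ∈ ((T.erase a : Finset (Pt d)) : Set (Pt d)), h.lam a z = 0 := fun z hz =>
      ((h.mem_hull_erase).1 (subset_convexHull ℝ _ hz)).2
    change ⟪h.grad a, x - y⟫ = 0
    rw [← h.lam_sub, aux x hx, aux y hy, sub_zero]
  · rw [Fintype.card_coe, hcard, hf]

-- From the barycenter of `T` to that of the side, `λ_a` drops from `1 / (d + 1)` to `0`, so the
-- component orthogonal to the side is a negative multiple of `∇λ_a`.
open Classical in
lemma outwardNormal_erase (hd : 0 < d) (a : T) :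
    outwardNormal T (T.erase a) = -(‖h.grad a‖⁻¹ • h.grad a) := by
  have hg := h.norm_grad_pos hd a
  set c : Pt d := (T.erase (a : Pt d)).centroid ℝ id - T.centroid ℝ id with hc
  have hin : ⟪h.grad a, c⟫ = -((d : ℝ) + 1)⁻¹ := by
    rw [hc, ← h.lam_sub, h.lam_centroid_of_notMem (Finset.erase_subset _ _)
      (h.nonempty_of_pos hd a) a (by simp), h.lam_centroid subset_rfl a a.2, h.card]
    push_cast; ring
  have hm : (vectorSpan ℝ ((T.erase a : Finset (Pt d)) : Set (Pt d)))ᗮ.starProjection c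
      = -(((d : ℝ) + 1)⁻¹ / ‖h.grad a‖ ^ 2) • h.grad a := by
    simp only [h.vectorSpan_erase hd a, Submodule.orthogonal_orthogonal]
    rw [Submodule.starProjection_singleton, hin]
    simp [neg_div]
  unfold outwardNormal
  simp only [← hc, hm]
  rw [norm_smul, Real.norm_eq_abs, abs_neg, abs_of_pos (by positivity), smul_smul, ← neg_smul]
  congr 1
  field_simp

end IsSimplex

lemma isCompact_hull (e : Finset (Pt d)) : IsCompact (hull e) :=
  (e.finite_toSet).isCompact_convexHull (𝕜 := ℝ)

lemma measurableSet_hull (e : Finset (Pt d)) : MeasurableSet (hull e) :=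
  (isCompact_hull e).isClosed.measurableSet

instance (e : Finset (Pt d)) : CompactSpace (hull e) := isCompact_iff_compactSpace.1 (isCompact_hull e)

end WG

/-! ### Sides, normals and the surface measure -/

namespace WG

variable {d : ℕ}

namespace IsSimplex

variable {T : Finset (Pt d)} (h : IsSimplex T)
include h

/-- The unit outward normal on the side opposite to the vertex `a`. -/
def normal (a : T) : Pt d := -(‖h.grad a‖⁻¹ • h.grad a)

lemma norm_normal (hd : 0 < d) (a : T) : ‖h.normal a‖ = 1 := by
  have := h.norm_grad_pos hd a
  rw [normal, norm_neg, norm_smul, norm_inv, norm_norm, inv_mul_cancel₀ this.ne']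

lemma grad_eq (hd : 0 < d) (a : T) : h.grad a = -(‖h.grad a‖ • h.normal a) := by
  have := h.norm_grad_pos hd a
  rw [normal, smul_neg, neg_neg, smul_smul, mul_inv_cancel₀ this.ne', one_smul]

/-- The distance from the vertex `a` to the opposite side. -/
def height (a : T) : ℝ := ‖h.grad a‖⁻¹

lemma height_pos (hd : 0 < d) (a : T) : 0 < h.height a := inv_pos.2 (h.norm_grad_pos hd a)

lemma inner_grad_normal (hd : 0 < d) (a : T) : ⟪h.grad a, h.normal a⟫ = -(h.height a)⁻¹ := by
  conv_lhs => rw [h.grad_eq hd]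
  rw [inner_neg_left, inner_smul_left, real_inner_self_eq_norm_sq, h.norm_normal hd]
  simp [height]

/-- The embedding, onto the hyperplane of the side opposite to `a`, of its direction. -/
def sideEmb (a : T) (w : (ℝ ∙ h.normal a)ᗮ) : Pt d := (a : Pt d) + h.height a • h.normal a + w

lemma sideEmb_isometry (a : T) : Isometry (h.sideEmb a) := by
  refine Isometry.of_dist_eq fun x y => ?_
  simp only [sideEmb, dist_add_left]; rfl

lemma continuous_sideEmb (a : T) : Continuous (h.sideEmb a) := (h.sideEmb_isometry a).continuous

lemma inner_grad_orthogonal (hd : 0 < d) (a : T) (w : (ℝ ∙ h.normal a)ᗮ) :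
    ⟪h.grad a, (w : Pt d)⟫ = 0 := by
  have := Submodule.mem_orthogonal_singleton_iff_inner_right.1 w.2
  rw [h.grad_eq hd, inner_neg_left, inner_smul_left, this, mul_zero, neg_zero]

lemma lam_sideEmb (hd : 0 < d) (a : T) (w) : h.lam a (h.sideEmb a w) = 0 := by
  rw [h.lam_eq a _ a, h.lam_vertex, if_pos rfl, sideEmb, add_assoc, add_sub_cancel_left,
    inner_add_right, inner_smul_right, h.inner_grad_normal hd, h.inner_grad_orthogonal hd]
  field_simp [(h.height_pos hd a).ne']
  ring

lemma exists_sideEmb (hd : 0 < d) (a : T) {x : Pt d} (hx : h.lam a x = 0) :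
    ∃ w, h.sideEmb a w = x := by
  refine ⟨⟨x - ((a : Pt d) + h.height a • h.normal a), ?_⟩, by simp [sideEmb]⟩
  have h1 := h.lam_sideEmb hd a 0
  have h2 := h.lam_sub a x (h.sideEmb a 0)
  rw [hx, h1, sub_zero, h.grad_eq hd, inner_neg_left, inner_smul_left] at h2
  rw [Submodule.mem_orthogonal_singleton_iff_inner_right]
  have := h.norm_grad_pos hd a
  simp only [sideEmb, ZeroMemClass.coe_zero, add_zero, conj_trivial] at h2
  nlinarith [mul_eq_zero.1 (neg_eq_zero.1 h2.symm)|>.resolve_left this.ne']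

lemma finrank_side (hd : 0 < d) (a : T) : Module.finrank ℝ (ℝ ∙ h.normal a)ᗮ = d - 1 := by
  have h1 := (ℝ ∙ h.normal a).finrank_add_finrank_orthogonal
  have : h.normal a ≠ 0 := norm_ne_zero_iff.1 (by rw [h.norm_normal hd]; exact one_ne_zero)
  rw [finrank_span_singleton this, finrank_euclideanSpace_fin] at h1
  omega

open Classical in
/-- The side opposite to `a`, in the coordinates given by `sideEmb`. -/
def sidePre (a : T) : Set (ℝ ∙ h.normal a)ᗮ := h.sideEmb a ⁻¹' hull (T.erase a)

open Classical in
lemma isCompact_sidePre (a : T) : IsCompact (h.sidePre a) :=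
  (h.sideEmb_isometry a).isClosedEmbedding.isCompact_preimage (WG.isCompact_hull _)

open Classical in
lemma hull_subset_range (hd : 0 < d) (a : T) :
    hull (T.erase (a : Pt d)) ⊆ Set.range (h.sideEmb a) := fun _ hx =>
  h.exists_sideEmb hd a (h.mem_hull_erase.1 hx).2

-- Euclidean Hausdorff measure is preserved by isometries and is Lebesgue measure on a `(d -
-- 1)`-dimensional inner product space, so surface measure can be computed in the coordinates
-- `sideEmb`.
open Classical in
lemma surf_apply (hd : 0 < d) (a : T) (S : Set (hull (T.erase (a : Pt d)))) :
    surf (T.erase a) S = volume (h.sideEmb a ⁻¹' (Subtype.val '' S)) := by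
  have h1 := isometry_subtype_coe.euclideanHausdorffMeasure_image (d := d - 1) S
  have h2 := (h.sideEmb_isometry a).euclideanHausdorffMeasure_preimage (d := d - 1)
    (Subtype.val '' S)
  rw [surf, ← h1, ← InnerProductSpace.euclideanHausdorffMeasure_eq_volume, h.finrank_side hd, h2,
    Set.inter_eq_left.2]
  exact (Subtype.coe_image_subset _ _).trans (h.hull_subset_range hd a)

open Classical in
lemma isFiniteMeasure_surf (hd : 0 < d) (a : T) :
    IsFiniteMeasure (surf (T.erase (a : Pt d))) := by
  refine ⟨?_⟩
  rw [h.surf_apply hd, Set.image_univ, Subtype.range_coe]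
  exact (h.isCompact_sidePre a).measure_lt_top

open Classical in
lemma isOpenPosMeasure_surf (hd : 0 < d) (a : T) :
    (surf (T.erase (a : Pt d))).IsOpenPosMeasure := by
  refine ⟨fun U hU ⟨x, hx⟩ => ?_⟩
  obtain ⟨V, hV, rfl⟩ := isOpen_induced_iff.1 hU
  rw [h.surf_apply hd]
  set c : Pt d := (T.erase (a : Pt d)).centroid ℝ id
  have hTs : T.erase (a : Pt d) ⊆ T := Finset.erase_subset _ _
  obtain ⟨hxT, hxa⟩ := h.mem_hull_erase.1 x.2
  have hca : h.lam a c = 0 :=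
    h.lam_centroid_of_notMem hTs (h.nonempty_of_pos hd a) a (by simp)
  have hmem : ∀ b : T, b ≠ a → (b : Pt d) ∈ T.erase (a : Pt d) := fun b hb =>
    Finset.mem_erase.2 ⟨fun hba => hb (Subtype.ext hba), b.2⟩
  have hcb : ∀ b, b ≠ a → 0 < h.lam b c := fun b hb => by
    rw [h.lam_centroid hTs b (hmem b hb)]
    have : 0 < (T.erase (a : Pt d)).card := Finset.card_pos.2 ⟨_, hmem b hb⟩
    positivity
  set O : Set (ℝ ∙ h.normal a)ᗮ :=
    h.sideEmb a ⁻¹' (V ∩ ⋂ b : T, {y | b ≠ a → 0 < h.lam b y}) with hO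
  have hOo : IsOpen O := by
    refine (hV.inter (isOpen_iInter_of_finite fun b => ?_)).preimage (h.continuous_sideEmb a)
    by_cases hb : b = a
    · simp [hb]
    · simpa [hb] using isOpen_lt continuous_const (h.continuous_lam b)
  have hne : O.Nonempty := by
    -- A given point of the side may be on its relative boundary; a small move towards the
    -- barycenter stays in `V` and makes all coordinates other than `λ_a` positive.
    have hcont : Continuous fun t : ℝ => (x : Pt d) + t • (c - x) := by fun_prop
    have : ∀ᶠ t in nhdsWithin (0 : ℝ) (Set.Ioi 0), (x : Pt d) + t • (c - x) ∈ V := by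
      refine (hcont.tendsto' 0 (x : Pt d) (by simp)).mono_left nhdsWithin_le_nhds |>.eventually
        (hV.mem_nhds hx)
    obtain ⟨t, htV, ht0, ht1⟩ := (this.and (Ioo_mem_nhdsGT one_pos)).exists
    have hl : ∀ b, h.lam b ((x : Pt d) + t • (c - x)) = (1 - t) * h.lam b x + t * h.lam b c := by
      intro b
      rw [h.lam_eq b _ x, add_sub_cancel_left, inner_smul_right, ← h.lam_sub]; ring
    obtain ⟨w, hw⟩ := h.exists_sideEmb hd a (x := (x : Pt d) + t • (c - x))
      (by rw [hl, hxa, hca]; ring)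
    refine ⟨w, ?_⟩
    rw [hO, Set.mem_preimage, hw]
    refine ⟨htV, Set.mem_iInter.2 fun b hb => ?_⟩
    rw [hl]
    have h1 := mul_nonneg (sub_nonneg.2 ht1.le) (h.mem_hull.1 hxT b)
    have h2 := mul_pos ht0 (hcb b hb)
    linarith
  refine (hOo.measure_pos volume hne).ne' ∘ fun h0 => measure_mono_null (fun w hw => ?_) h0
  have hw' : h.sideEmb a w ∈ V ∩ ⋂ b : T, {y | b ≠ a → 0 < h.lam b y} := hw
  have hz := h.lam_sideEmb hd a w
  have hin : h.sideEmb a w ∈ hull (T.erase (a : Pt d)) := by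
    refine h.mem_hull_erase.2 ⟨h.mem_hull.2 fun b => ?_, hz⟩
    by_cases hb : b = a
    · rw [hb, hz]
    · exact (Set.mem_iInter.1 hw'.2 b hb).le
  exact ⟨⟨_, hin⟩, hw'.1, rfl⟩

open Classical in
lemma integral_surf (hd : 0 < d) (a : T) (F : Pt d → ℝ) :
    ∫ x : hull (T.erase (a : Pt d)), F x ∂(surf (T.erase (a : Pt d)))
      = ∫ w in h.sidePre a, F (h.sideEmb a w) := by
  set e := T.erase (a : Pt d)
  have hem : MeasurableEmbedding (h.sideEmb a) :=
    (h.sideEmb_isometry a).isClosedEmbedding.measurableEmbedding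
  have hcl : MeasurableSet (hull e) := (WG.isCompact_hull e).isClosed.measurableSet
  have h1 := (isometry_subtype_coe (s := hull e)).map_euclideanHausdorffMeasure (d := d - 1)
  have h2 := (h.sideEmb_isometry a).map_euclideanHausdorffMeasure (d := d - 1)
  have h3 : (Measure.euclideanHausdorffMeasure (d - 1) : Measure (ℝ ∙ h.normal a)ᗮ) = volume := by
    rw [← InnerProductSpace.euclideanHausdorffMeasure_eq_volume, h.finrank_side hd]
  rw [Subtype.range_coe] at h1
  rw [h3] at h2
  have h4 : (Measure.euclideanHausdorffMeasure (d - 1) : Measure (Pt d)).restrict (hull e)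
      = (volume.map (h.sideEmb a)).restrict (hull e) := by
    rw [h2, Measure.restrict_restrict hcl, Set.inter_eq_left.2 (h.hull_subset_range hd a)]
  have h5 := (MeasurableEmbedding.subtype_coe hcl).integral_map (μ := surf e) F
  rw [← h5, surf, h1, h4, hem.setIntegral_map]
  rfl

end IsSimplex

end WG

/-! ### The divergence theorem on a simplex -/

namespace WG

variable {d : ℕ}

namespace IsSimplex

variable {T : Finset (Pt d)} (h : IsSimplex T)
include h

/-! ### Integration over a simplex in cone coordinates from a vertex. -/

lemma integral_eq_iterated (hd : 0 < d) (a : T) (G : Pt d → ℝ) (hG : Integrable G) :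
    ∫ x, G x = ∫ t : ℝ, ∫ w : (ℝ ∙ h.normal a)ᗮ, G (a + t • h.normal a + w) := by
  set s : Submodule ℝ (Pt d) := ℝ ∙ h.normal a
  have e1 := (s.measurePreserving_measurableEquivProd (a : Pt d)).symm
  rw [InnerProductSpace.euclideanHausdorffMeasure_eq_volume] at e1
  have e2 := (LinearIsometryEquiv.toSpanUnitSingleton (𝕜 := ℝ) (h.normal a)
    (h.norm_normal hd a)).measurePreserving
  have e3 := e2.prod (MeasurePreserving.id (volume : Measure sᗮ))
  have e4 := e1.comp e3
  have hemb : MeasurableEmbedding ((s.measurableEquivProd (a : Pt d)).symm ∘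
      Prod.map (LinearIsometryEquiv.toSpanUnitSingleton (𝕜 := ℝ) (h.normal a)
    (h.norm_normal hd a)) (id : sᗮ → sᗮ)) := by
    refine (s.measurableEquivProd (a : Pt d)).symm.measurableEmbedding.comp ?_
    exact ((LinearIsometryEquiv.toSpanUnitSingleton (𝕜 := ℝ) (h.normal a)
      (h.norm_normal hd a)).toHomeomorph.prodCongr (Homeomorph.refl _)).measurableEmbedding
  have h1 := e4.integral_comp hemb G
  rw [← h1, integral_prod]
  · refine integral_congr_ae (Filter.Eventually.of_forall fun t =>
      integral_congr_ae (Filter.Eventually.of_forall fun w => ?_))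
    simp only [Function.comp_apply, Prod.map_apply, id, Submodule.measurableEquivProd_symm_apply,
      LinearIsometryEquiv.toSpanUnitSingleton_apply]
    congr 1
    rw [vadd_eq_add]; abel
  · exact (e4.integrable_comp_emb hemb).2 hG

/-- A point on the ray from the vertex `a` through the point `sideEmb a w`. -/
def ray (a : T) (s : ℝ) (w : (ℝ ∙ h.normal a)ᗮ) : Pt d := a + s • (h.sideEmb a w - a)

lemma ray_eq (a : T) (s : ℝ) (w) :
    h.ray a s w = a + (s * h.height a) • h.normal a + s • (w : Pt d) := by
  simp only [ray, sideEmb, smul_smul, add_assoc, add_sub_cancel_left, smul_add]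

/-- Along the ray the coordinate of `a` is `1 - s`, and every other coordinate is `s` times its
value at the foot point on the opposite hyperplane. -/
lemma ray_mem_hull (hd : 0 < d) (a : T) {s : ℝ} (hs : 0 < s) (w) :
    h.ray a s w ∈ hull T ↔ s ≤ 1 ∧ w ∈ h.sidePre a := by
  classical
  have hl : ∀ b, h.lam b (h.ray a s w) = (1 - s) * h.lam b a + s * h.lam b (h.sideEmb a w) := by
    intro b
    rw [h.lam_eq b _ a, ray, add_sub_cancel_left, inner_smul_right, ← h.lam_sub]; ring
  have h0 := h.lam_sideEmb hd a w
  rw [sidePre, Set.mem_preimage, h.mem_hull_erase, h.mem_hull, h.mem_hull]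
  simp only [hl, h0, and_true]
  constructor
  · intro hh
    refine ⟨?_, fun b => ?_⟩
    · have := hh a
      rw [h0, h.lam_vertex, if_pos rfl] at this
      linarith
    · by_cases hb : b = a
      · rw [hb, h0]
      · have := hh b
        rw [h.lam_vertex, if_neg hb, mul_zero, zero_add] at this
        exact nonneg_of_mul_nonneg_right this hs
  · rintro ⟨h1, h2⟩ b
    have hv : 0 ≤ h.lam b a := by rw [h.lam_vertex]; split_ifs <;> norm_num
    have := mul_nonneg (sub_nonneg.2 h1) hv
    have := mul_nonneg hs.le (h2 b)
    linarith

lemma notMem_hull_of_neg (hd : 0 < d) (a : T) {t : ℝ} (ht : t < 0) (w : (ℝ ∙ h.normal a)ᗮ) :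
    (a : Pt d) + t • h.normal a + w ∉ hull T := by
  classical
  rw [h.mem_hull]
  intro hh
  have h1 : h.lam a (a + t • h.normal a + w) ≤ 1 := by
    rw [← h.sum_lam (a + t • h.normal a + w)]
    exact Finset.single_le_sum (f := fun b => h.lam b (a + t • h.normal a + w))
      (fun b _ => hh b) (Finset.mem_univ a)
  rw [h.lam_eq a _ a, h.lam_vertex, if_pos rfl, add_assoc, add_sub_cancel_left, inner_add_right,
    inner_smul_right, h.inner_grad_normal hd, h.inner_grad_orthogonal hd] at h1
  have := mul_pos_of_neg_of_neg ht (neg_lt_zero.2 (inv_pos.2 (h.height_pos hd a)))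
  linarith

lemma integral_hull_eq_ray (hd : 0 < d) (a : T) (F : Pt d → ℝ) (hF : Continuous F) :
    ∫ x in hull T, F x = h.height a * ∫ s in (0 : ℝ)..1, s ^ (d - 1) *
      ∫ w in h.sidePre a, F (h.ray a s w) := by
  have hH := h.height_pos hd a
  have hint : Integrable ((hull T).indicator F) := by
    rw [integrable_indicator_iff (WG.measurableSet_hull T)]
    exact hF.continuousOn.integrableOn_compact (WG.isCompact_hull T)
  rw [← integral_indicator (WG.measurableSet_hull T), h.integral_eq_iterated hd a _ hint]
  set Φ : ℝ → ℝ := fun t => ∫ w : (ℝ ∙ h.normal a)ᗮ,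
    (hull T).indicator F (a + t • h.normal a + w) with hΦ
  -- Substitute `t = height * s`, so that `s = 0` is the vertex and `s = 1` the opposite side.
  have hsc : ∫ t, Φ t = h.height a * ∫ s, Φ (h.height a * s) := by
    rw [Measure.integral_comp_mul_left, abs_of_pos (inv_pos.2 hH), smul_eq_mul,
      mul_inv_cancel_left₀ hH.ne']
  have hval : ∀ s : ℝ, 0 < s → Φ (h.height a * s) = (Set.Ioc (0 : ℝ) 1).indicator
      (fun s => s ^ (d - 1) * ∫ w in h.sidePre a, F (h.ray a s w)) s := by
    intro s hs
    -- The slice at parameter `s` is the side scaled by `s`; scaling in dimension `d - 1` produces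
    -- the weight `s ^ (d - 1)`.
    have hcs := Measure.integral_comp_smul_of_nonneg (volume : Measure (ℝ ∙ h.normal a)ᗮ)
      (fun w => (hull T).indicator F (a + (h.height a * s) • h.normal a + w)) s (hR := hs.le)
    rw [h.finrank_side hd] at hcs
    have hcs' : Φ (h.height a * s) = s ^ (d - 1) *
        ∫ w : (ℝ ∙ h.normal a)ᗮ, (hull T).indicator F (h.ray a s w) := by
      simp only [h.ray_eq, mul_comm s (h.height a)]
      rw [smul_eq_mul] at hcs
      simp only [Submodule.coe_smul] at hcs
      rw [hcs, ← mul_assoc, mul_inv_cancel₀ (pow_pos hs _).ne', one_mul]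
    rw [hcs']
    by_cases h1 : s ≤ 1
    · rw [Set.indicator_of_mem (show s ∈ Set.Ioc (0 : ℝ) 1 from ⟨hs, h1⟩),
        ← integral_indicator (h.isCompact_sidePre a).isClosed.measurableSet]
      congr 2
      ext w
      by_cases hw : w ∈ h.sidePre a
      · rw [Set.indicator_of_mem hw, Set.indicator_of_mem ((h.ray_mem_hull hd a hs w).2 ⟨h1, hw⟩)]
      · rw [Set.indicator_of_notMem hw, Set.indicator_of_notMem
          (fun hh => hw ((h.ray_mem_hull hd a hs w).1 hh).2)]
    · rw [Set.indicator_of_notMem (fun hh => h1 hh.2)]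
      have : ∀ w, (hull T).indicator F (h.ray a s w) = 0 := fun w =>
        Set.indicator_of_notMem (fun hh => h1 ((h.ray_mem_hull hd a hs w).1 hh).1) _
      simp [this]
  have hneg : ∀ s : ℝ, s < 0 → Φ (h.height a * s) = (Set.Ioc (0 : ℝ) 1).indicator
      (fun s => s ^ (d - 1) * ∫ w in h.sidePre a, F (h.ray a s w)) s := by
    intro s hs
    rw [Set.indicator_of_notMem (fun hh => hs.not_gt hh.1), hΦ]
    have : ∀ w : (ℝ ∙ h.normal a)ᗮ,
        (hull T).indicator F (a + (h.height a * s) • h.normal a + w) = 0 := fun w =>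
      Set.indicator_of_notMem (h.notMem_hull_of_neg hd a (mul_neg_of_pos_of_neg hH hs) w) _
    simp [this]
  rw [hsc, intervalIntegral.integral_of_le zero_le_one, ← integral_indicator measurableSet_Ioc]
  congr 1
  refine integral_congr_ae ?_
  have : ∀ᵐ s : ℝ, s ≠ 0 := by simp [ae_iff, measure_singleton]
  filter_upwards [this] with s hs
  rcases lt_or_gt_of_ne hs with h1 | h1
  · exact hneg s h1
  · exact hval s h1

/-- The divergence theorem for radial fields, centred at a vertex. -/
lemma integral_radial (hd : 0 < d) (a : T) (F : Pt d → ℝ) (hF : ContDiff ℝ 1 F) :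
    ∫ x in hull T, (d * F x + fderiv ℝ F x (x - a)) = h.height a *
      ∫ w in h.sidePre a, F (h.sideEmb a w) := by
  have hdF : Continuous (fderiv ℝ F) := hF.continuous_fderiv one_ne_zero
  have hc : Continuous fun x : Pt d => d * F x + fderiv ℝ F x (x - a) := by
    have := hF.continuous
    fun_prop
  rw [h.integral_hull_eq_ray hd a _ hc]
  congr 1
  have hray : Continuous fun p : ℝ × (ℝ ∙ h.normal a)ᗮ => h.ray a p.1 p.2 := by
    have := h.continuous_sideEmb a
    unfold ray
    fun_prop
  have hcont : Continuous fun p : ℝ × (ℝ ∙ h.normal a)ᗮ => p.1 ^ (d - 1) *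
      (d * F (h.ray a p.1 p.2) + fderiv ℝ F (h.ray a p.1 p.2) (h.ray a p.1 p.2 - a)) :=
    (continuous_fst.pow _).mul (hc.comp hray)
  simp_rw [← integral_const_mul]
  rw [intervalIntegral.integral_of_le zero_le_one, integral_integral_swap]
  · refine setIntegral_congr_fun (h.isCompact_sidePre a).isClosed.measurableSet fun w _ => ?_
    -- The integrand is an exact derivative along the ray, so integrating in `s` leaves the value of
    -- `F` on the side; the term at `s = 0` vanishes because `d > 0`.
    have hder : ∀ s ∈ Set.uIcc (0 : ℝ) 1, HasDerivAt (fun s => s ^ d * F (h.ray a s w))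
        (s ^ (d - 1) * (d * F (h.ray a s w) + fderiv ℝ F (h.ray a s w) (h.ray a s w - a))) s := by
      intro s _
      have h1 : HasDerivAt (fun s => h.ray a s w) (h.sideEmb a w - a) s := by
        have := ((hasDerivAt_id s).smul_const (h.sideEmb a w - a)).const_add (a : Pt d)
        simpa [ray] using this
      have h2 := ((hF.differentiable one_ne_zero) (h.ray a s w)).hasFDerivAt.comp_hasDerivAt s h1
      have h3 := (hasDerivAt_pow d s).mul h2
      refine h3.congr_deriv ?_
      have h4 : h.ray a s w - a = s • (h.sideEmb a w - a) := by simp [ray]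
      rw [h4, map_smul, smul_eq_mul]
      have h5 : s ^ d = s ^ (d - 1) * s := by rw [← pow_succ]; congr 1; omega
      simp only [Function.comp_apply]
      rw [h5]; ring
    have := intervalIntegral.integral_eq_sub_of_hasDerivAt hder
      ((hcont.comp (Continuous.prodMk_left w)).intervalIntegrable _ _)
    rw [intervalIntegral.integral_of_le zero_le_one] at this
    refine this.trans ?_
    simp [ray, hd.ne']
  · rw [Function.uncurry_def, Measure.prod_restrict]
    refine IntegrableOn.mono_set ?_ (Set.prod_mono_left Set.Ioc_subset_Icc_self)
    exact hcont.continuousOn.integrableOn_compact (isCompact_Icc.prod (h.isCompact_sidePre a))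

open Classical in
/-- The divergence theorem on a simplex. -/
theorem integral_fderiv (hd : 0 < d) (F : Pt d → ℝ) (hF : ContDiff ℝ 1 F) (z : Pt d) :
    ∫ x in hull T, fderiv ℝ F x z = ∑ a : T, ∫ x : hull (T.erase (a : Pt d)),
      F x * ⟪outwardNormal T (T.erase (a : Pt d)), z⟫ ∂(surf (T.erase (a : Pt d))) := by
  have hdF : Continuous (fderiv ℝ F) := hF.continuous_fderiv one_ne_zero
  have hFc := hF.continuous
  have hi : ∀ G : Pt d → ℝ, Continuous G → IntegrableOn G (hull T) := fun G hG =>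
    hG.continuousOn.integrableOn_compact (WG.isCompact_hull T)
  -- Since `∑ ∇λ_a = 0` and `∑ ⟪∇λ_a, z⟫ a = z`, the constant field `z` equals `-∑ ⟪∇λ_a, z⟫ (x -
  -- a)`. The radial formula at each vertex `a` gives the flux through the side opposite to `a`.
  have key : ∀ a : T, ∫ x : hull (T.erase (a : Pt d)),
      F x * ⟪outwardNormal T (T.erase (a : Pt d)), z⟫ ∂(surf (T.erase (a : Pt d)))
      = ∫ x in hull T, -(⟪h.grad a, z⟫ * (d * F x + fderiv ℝ F x (x - a))) := by
    intro a
    rw [integral_mul_const, h.integral_surf hd, h.outwardNormal_erase hd, integral_neg,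
      integral_const_mul, h.integral_radial hd a F hF, inner_neg_left, inner_smul_left, height]
    simp only [conj_trivial]
    ring
  rw [Finset.sum_congr rfl fun a _ => key a, ← integral_finsetSum]
  · refine setIntegral_congr_fun (WG.measurableSet_hull T) fun x _ => ?_
    simp only [map_sub]
    have e1 : ∑ a, ⟪h.grad a, z⟫ = 0 := by rw [← sum_inner, h.sum_grad, inner_zero_left]
    have e2 : ∑ a, ⟪h.grad a, z⟫ * fderiv ℝ F x a = fderiv ℝ F x z := by
      conv_rhs => rw [← h.sum_inner_grad_smul z]
      simp [map_sum]
    calc fderiv ℝ F x z = ∑ a, ⟪h.grad a, z⟫ * fderiv ℝ F x a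
          - (∑ a, ⟪h.grad a, z⟫) * (d * F x + fderiv ℝ F x x) := by rw [e1, e2]; ring
      _ = _ := by
        rw [Finset.sum_mul, ← Finset.sum_sub_distrib]
        exact Finset.sum_congr rfl fun a _ => by ring
  · intro a _
    refine hi _ ?_
    fun_prop

end IsSimplex

end WG

/-! ### Polynomials and barycentric coordinates -/

namespace WG

variable {d : ℕ}

section pval

variable (p q : MvPolynomial (Fin d) ℝ) (x : Pt d)

@[simp] lemma pval_add : pval (p + q) x = pval p x + pval q x := by simp [pval]
@[simp] lemma pval_sub : pval (p - q) x = pval p x - pval q x := by simp [pval]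
@[simp] lemma pval_mul : pval (p * q) x = pval p x * pval q x := by simp [pval]
@[simp] lemma pval_smul (c : ℝ) : pval (c • p) x = c * pval p x := by simp [pval]
@[simp] lemma pval_zero : pval (0 : MvPolynomial (Fin d) ℝ) x = 0 := by simp [pval]
@[simp] lemma pval_C (c : ℝ) : pval (MvPolynomial.C c) x = c := by simp [pval]
@[simp] lemma pval_X (i : Fin d) : pval (MvPolynomial.X i) x = x i := by simp [pval]
@[simp] lemma pval_sum {ι : Type*} (s : Finset ι) (f : ι → MvPolynomial (Fin d) ℝ) :
    pval (∑ i ∈ s, f i) x = ∑ i ∈ s, pval (f i) x := by simp [pval]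

lemma pval_eq_aeval : pval p x = MvPolynomial.aeval (fun i => x i) p := by
  simp [pval]

lemma continuous_pval : Continuous (pval p) :=
  (MvPolynomial.continuous_eval p).comp (by fun_prop)

lemma hasFDerivAt_pval : HasFDerivAt (pval p)
    (∑ i, pval (MvPolynomial.pderiv i p) x • (EuclideanSpace.proj i : Pt d →L[ℝ] ℝ)) x := by
  induction p using MvPolynomial.induction_on with
  | C c =>
    have : pval (MvPolynomial.C c : MvPolynomial (Fin d) ℝ) = fun _ => c := by ext; simp
    rw [this]
    simpa using hasFDerivAt_const c x
  | add p q hp hq =>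
    have : pval (p + q) = pval p + pval q := by ext; simp
    rw [this]
    refine (hp.add hq).congr_fderiv ?_
    simp [add_smul, Finset.sum_add_distrib]
  | mul_X p j hp =>
    have : pval (p * MvPolynomial.X j) = fun y => pval p y * (EuclideanSpace.proj j : Pt d →L[ℝ] ℝ) y := by
      ext; simp
    rw [this]
    refine (hp.mul (EuclideanSpace.proj j : Pt d →L[ℝ] ℝ).hasFDerivAt).congr_fderiv ?_
    ext z
    simp only [Derivation.leibniz, smul_eq_mul, MvPolynomial.pderiv_X, pval_add, pval_mul, pval_X,
      add_apply, smul_apply, sum_apply,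
      add_smul, Finset.sum_add_distrib]
    congr 1
    · rw [Finset.sum_eq_single j]
      · simp [pval]
      · intro b _ hb
        simp [hb.symm]
      · simp
    · rw [Finset.mul_sum]
      exact Finset.sum_congr rfl fun i _ => by simp [mul_assoc]

lemma fderiv_pval (z : Pt d) :
    fderiv ℝ (pval p) x z = ∑ i, pval (MvPolynomial.pderiv i p) x * z i := by
  rw [(hasFDerivAt_pval p x).fderiv]
  simp

lemma contDiff_pval {n : WithTop ℕ∞} : ContDiff ℝ n (pval p) := by
  induction p using MvPolynomial.induction_on with
  | C c =>
    have : pval (MvPolynomial.C c : MvPolynomial (Fin d) ℝ) = fun _ => c := by ext; simp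
    rw [this]; exact contDiff_const
  | add p q hp hq =>
    have : pval (p + q) = pval p + pval q := by ext; simp
    rw [this]; exact hp.add hq
  | mul_X p j hp =>
    have : pval (p * MvPolynomial.X j) = fun y => pval p y * (EuclideanSpace.proj j : Pt d →L[ℝ] ℝ) y := by
      ext; simp
    rw [this]; exact hp.mul (ContinuousLinearMap.contDiff _)

variable {p}

/-- A nonempty open set contains a box, which is a product of infinite sets of reals. -/
lemma eq_zero_of_pval_eq_zero {U : Set (Pt d)} (hU : IsOpen U) (hne : U.Nonempty)
    (h0 : ∀ x ∈ U, pval p x = 0) : p = 0 := by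
  obtain ⟨x, hx⟩ := hne
  have hU' : IsOpen ((WithLp.toLp 2 : (Fin d → ℝ) → Pt d) ⁻¹' U) :=
    hU.preimage (PiLp.continuous_toLp 2 _)
  obtain ⟨ε, hε, hb⟩ := Metric.isOpen_iff.1 hU' (WithLp.ofLp x) (by simpa using hx)
  refine MvPolynomial.funext_set (fun i => Metric.ball (x i) ε) (fun i => ?_) fun y hy => ?_
  · rw [Real.ball_eq_Ioo]
    exact Set.Ioo_infinite (by linarith)
  · have : y ∈ Metric.ball (WithLp.ofLp x) ε := by
      rw [ball_pi _ hε]; exact hy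
    simpa [pval] using h0 _ (hb this)

end pval

lemma mem_Poly {k : ℕ} {p : MvPolynomial (Fin d) ℝ} : p ∈ Poly d k ↔ p.totalDegree ≤ k :=
  MvPolynomial.mem_restrictTotalDegree _ _ _

lemma C_mul_mem_Poly {k : ℕ} {p : MvPolynomial (Fin d) ℝ} (c : ℝ) (hp : p ∈ Poly d k) :
    MvPolynomial.C c * p ∈ Poly d k := by
  rw [← MvPolynomial.smul_eq_C_mul]; exact Submodule.smul_mem _ _ hp

lemma mul_mem_Poly {k l : ℕ} {p q : MvPolynomial (Fin d) ℝ} (hp : p ∈ Poly d k)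
    (hq : q ∈ Poly d l) : p * q ∈ Poly d (k + l) := by
  rw [mem_Poly] at *
  exact (MvPolynomial.totalDegree_mul _ _).trans (add_le_add hp hq)

lemma X_mem_Poly (i : Fin d) : (MvPolynomial.X i : MvPolynomial (Fin d) ℝ) ∈ Poly d 1 := by
  rw [mem_Poly, MvPolynomial.totalDegree_X]

lemma Poly_mono {k l : ℕ} (hkl : k ≤ l) : Poly d k ≤ Poly d l := fun p hp => by
  rw [mem_Poly] at *; exact hp.trans hkl

/-- The polynomial `x ↦ g · x`. -/
def linPoly (g : Pt d) : MvPolynomial (Fin d) ℝ := ∑ i, MvPolynomial.C (g i) * MvPolynomial.X i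

@[simp] lemma pval_linPoly (g x : Pt d) : pval (linPoly g) x = ⟪g, x⟫ := by
  simp [linPoly, PiLp.inner_apply, mul_comm]

namespace IsSimplex

variable {T : Finset (Pt d)} (h : IsSimplex T)
include h

/-- The barycentric coordinate of the vertex `a` as a polynomial. -/
def lamPoly (a : T) : MvPolynomial (Fin d) ℝ := linPoly (h.grad a) + MvPolynomial.C (h.lam a 0)

@[simp] lemma pval_lamPoly (a : T) (x : Pt d) : pval (h.lamPoly a) x = h.lam a x := by
  rw [h.lam_eq a x 0]
  simp [lamPoly, add_comm]

lemma lamPoly_ne_zero (a : T) : h.lamPoly a ≠ 0 := by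
  classical
  intro h0
  have := h.pval_lamPoly a a
  rw [h0, pval_zero, h.lam_vertex, if_pos rfl] at this
  exact zero_ne_one this

lemma one_le_totalDegree_lamPoly (hd : 0 < d) (a : T) : 1 ≤ (h.lamPoly a).totalDegree := by
  classical
  by_contra hlt
  have h0 : (h.lamPoly a).totalDegree = 0 := by omega
  rw [MvPolynomial.totalDegree_eq_zero_iff_eq_C] at h0
  obtain ⟨b, hb⟩ := h.nonempty_of_pos hd a
  obtain ⟨hb1, hb2⟩ := Finset.mem_erase.1 hb
  have h1 := h.pval_lamPoly a a
  have h2 := h.pval_lamPoly a b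
  rw [h0, pval_C, h.lam_vertex, if_pos rfl] at h1
  rw [h0, pval_C, h1, h.lam_vertex a ⟨b, hb2⟩, if_neg (by rintro rfl; exact hb1 rfl)] at h2
  exact one_ne_zero h2

lemma mem_Poly_of_lamPoly_mul (hd : 0 < d) (a : T) {k : ℕ} {p : MvPolynomial (Fin d) ℝ}
    (hp : h.lamPoly a * p ∈ Poly d (k + 1)) : p ∈ Poly d k := by
  by_cases h0 : p = 0
  · rw [h0]; exact Submodule.zero_mem _
  rw [mem_Poly] at *
  rw [MvPolynomial.totalDegree_mul_of_isDomain (h.lamPoly_ne_zero a) h0] at hp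
  have := h.one_le_totalDegree_lamPoly hd a
  omega

lemma eq_zero_of_pval_hull {p : MvPolynomial (Fin d) ℝ} (h0 : ∀ x ∈ hull T, pval p x = 0) :
    p = 0 :=
  eq_zero_of_pval_eq_zero isOpen_interior ⟨_, h.centroid_mem_interior⟩
    fun x hx => h0 x (interior_subset hx)

-- `σ` substitutes the orthogonal projection `x ↦ x - λ_a(x) t` onto the hyperplane `λ_a = 0`, so `σ
-- p` and `p` agree modulo `λ_a`. The points that project into the relative interior of the side
-- contain a nonempty open set, on which `σ p` vanishes; hence `σ p = 0`.
open Classical in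
lemma lamPoly_dvd (hd : 0 < d) (a : T) {p : MvPolynomial (Fin d) ℝ}
    (h0 : ∀ x ∈ hull (T.erase (a : Pt d)), pval p x = 0) : h.lamPoly a ∣ p := by
  set t : Pt d := -(h.height a • h.normal a)
  have ht : ⟪h.grad a, t⟫ = 1 := by
    rw [inner_neg_right, inner_smul_right, h.inner_grad_normal hd, mul_neg, neg_neg,
      mul_inv_cancel₀ (h.height_pos hd a).ne']
  set σ : MvPolynomial (Fin d) ℝ →ₐ[ℝ] MvPolynomial (Fin d) ℝ :=
    MvPolynomial.aeval fun i => MvPolynomial.X i - MvPolynomial.C (t i) * h.lamPoly a with hσ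
  have hdvd : h.lamPoly a ∣ p - σ p := by
    rw [← Ideal.mem_span_singleton, ← Ideal.Quotient.eq]
    have : (Ideal.Quotient.mkₐ ℝ (Ideal.span {h.lamPoly a})) =
        (Ideal.Quotient.mkₐ ℝ (Ideal.span {h.lamPoly a})).comp σ := by
      refine MvPolynomial.algHom_ext fun i => ?_
      rw [AlgHom.comp_apply, hσ, MvPolynomial.aeval_X]
      refine Ideal.Quotient.eq.2 (Ideal.mem_span_singleton.2 ?_)
      rw [sub_sub_cancel]
      exact dvd_mul_left _ _
    exact DFunLike.congr_fun this p
  have hval : ∀ x, pval (σ p) x = pval p (x - h.lam a x • t) := by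
    intro x
    have : ((MvPolynomial.aeval fun i => x i : MvPolynomial (Fin d) ℝ →ₐ[ℝ] ℝ).comp σ) =
        MvPolynomial.aeval fun i => (x - h.lam a x • t) i := by
      refine MvPolynomial.algHom_ext fun i => ?_
      rw [AlgHom.comp_apply, hσ, MvPolynomial.aeval_X]
      rw [MvPolynomial.aeval_X, map_sub, ← pval_eq_aeval, ← pval_eq_aeval, pval_mul, pval_C, pval_X,
        h.pval_lamPoly]
      simp [mul_comm]
    have := DFunLike.congr_fun this p
    rwa [AlgHom.comp_apply, ← pval_eq_aeval, ← pval_eq_aeval] at this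
  set O : Set (Pt d) := ⋂ b : T, {x | b ≠ a → 0 < h.lam b (x - h.lam a x • t)}
  have hO : IsOpen O := isOpen_iInter_of_finite fun b => by
    by_cases hb : b = a
    · simp [hb]
    · have h1 := h.continuous_lam b
      have h2 := h.continuous_lam a
      simpa [hb] using isOpen_lt continuous_const
        (h1.comp (continuous_id.sub (h2.smul continuous_const)))
  have hTs : T.erase (a : Pt d) ⊆ T := Finset.erase_subset _ _
  have hσ0 : σ p = 0 := by
    refine eq_zero_of_pval_eq_zero hO ⟨(T.erase (a : Pt d)).centroid ℝ id, ?_⟩ fun x hx => ?_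
    · refine Set.mem_iInter.2 fun b hb => ?_
      have hbm : (b : Pt d) ∈ T.erase (a : Pt d) :=
        Finset.mem_erase.2 ⟨fun hba => hb (Subtype.ext hba), b.2⟩
      rw [h.lam_centroid_of_notMem hTs ⟨_, hbm⟩ a (by simp), zero_smul, sub_zero,
        h.lam_centroid hTs b hbm]
      have : 0 < (T.erase (a : Pt d)).card := Finset.card_pos.2 ⟨_, hbm⟩
      positivity
    · rw [hval]
      have ha : h.lam a (x - h.lam a x • t) = 0 := by
        rw [h.lam_eq a _ x, sub_sub_cancel_left, inner_neg_right, inner_smul_right, ht]; ring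
      refine h0 _ (h.mem_hull_erase.2 ⟨h.mem_hull.2 fun b => ?_, ha⟩)
      by_cases hb : b = a
      · rw [hb, ha]
      · exact (Set.mem_iInter.1 hx b hb).le
  rwa [hσ0, sub_zero] at hdvd

end IsSimplex

lemma restrictPoly_apply (S : Set (Pt d)) (p : MvPolynomial (Fin d) ℝ) (x : S) :
    restrictPoly S p x = pval p x := by
  simp [restrictPoly, pval]

lemma restrictPoly_mem {k : ℕ} {e : Finset (Pt d)} {p : MvPolynomial (Fin d) ℝ}
    (hp : p ∈ Poly d k) : restrictPoly (hull e) p ∈ FacePoly k e := ⟨p, hp, rfl⟩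

lemma exists_pval {k : ℕ} {e : Finset (Pt d)} (φ : FacePoly k e) :
    ∃ p ∈ Poly d k, ∀ x, φ.1 x = pval p x := by
  obtain ⟨p, hp, hφ⟩ := φ.2
  exact ⟨p, hp, fun x => by rw [← hφ, restrictPoly_apply]⟩

lemma continuous_facePoly {k : ℕ} {e : Finset (Pt d)} (φ : FacePoly k e) : Continuous φ.1 := by
  obtain ⟨p, -, hφ⟩ := exists_pval φ
  rw [show φ.1 = fun x : hull e => pval p x from funext hφ]
  exact (continuous_pval p).comp continuous_subtype_val

end WG

namespace WG

variable {d : ℕ}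

/-! ### Integration functionals -/

lemma integrableOn_pval (T : Finset (Pt d)) (p : MvPolynomial (Fin d) ℝ) :
    IntegrableOn (pval p) (hull T) :=
  (continuous_pval p).continuousOn.integrableOn_compact (isCompact_hull T)

/-- Integration of polynomials over a closed simplex. -/
def cellInt (T : Finset (Pt d)) : MvPolynomial (Fin d) ℝ →ₗ[ℝ] ℝ where
  toFun p := ∫ x in hull T, pval p x
  map_add' p q := by
    simp only [pval_add]
    exact integral_add (integrableOn_pval T p) (integrableOn_pval T q)
  map_smul' c p := by
    simp only [pval_smul, RingHom.id_apply, smul_eq_mul]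
    exact integral_const_mul _ _

lemma cellInt_apply (T : Finset (Pt d)) (p : MvPolynomial (Fin d) ℝ) :
    cellInt T p = ∫ x in hull T, pval p x := rfl

lemma integrable_surf {e : Finset (Pt d)} [IsFiniteMeasure (surf e)] {f : hull e → ℝ}
    (hf : Continuous f) : Integrable f (surf e) :=
  hf.integrable_of_hasCompactSupport (HasCompactSupport.of_compactSpace f)

/-- Integration of continuous functions over a side. -/
def surfInt (e : Finset (Pt d)) [IsFiniteMeasure (surf e)] : C(hull e, ℝ) →ₗ[ℝ] ℝ where
  toFun f := ∫ x, f x ∂(surf e)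
  map_add' f g := integral_add (integrable_surf f.continuous) (integrable_surf g.continuous)
  map_smul' c _ := integral_const_mul c _

lemma surfInt_apply (e : Finset (Pt d)) [IsFiniteMeasure (surf e)] (f : C(hull e, ℝ)) :
    surfInt e f = ∫ x, f x ∂(surf e) := rfl

lemma eq_zero_of_surfInt_mul_self {e : Finset (Pt d)} [IsFiniteMeasure (surf e)]
    [(surf e).IsOpenPosMeasure] {f : C(hull e, ℝ)} (h0 : surfInt e (f * f) = 0) : f = 0 := by
  have hc : Continuous fun x => f x * f x := f.continuous.mul f.continuous
  have h1 := (integral_eq_zero_iff_of_nonneg (fun x => mul_self_nonneg (f x))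
    (integrable_surf hc)).1 h0
  have h2 := (hc.ae_eq_iff_eq (surf e) continuous_const).1 h1
  ext x
  exact mul_self_eq_zero.1 (congr_fun h2 x)

lemma surfInt_mul_self_nonneg {e : Finset (Pt d)} [IsFiniteMeasure (surf e)] (f : C(hull e, ℝ)) :
    0 ≤ surfInt e (f * f) := integral_nonneg fun x => mul_self_nonneg (f x)

lemma cellInt_mul_self_nonneg (T : Finset (Pt d)) (p : MvPolynomial (Fin d) ℝ) :
    0 ≤ cellInt T (p * p) := by
  rw [cellInt_apply]
  exact integral_nonneg fun x => by rw [pval_mul]; exact mul_self_nonneg _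

/-- Restriction of polynomials to a side, as continuous functions. -/
def polyC (e : Finset (Pt d)) : MvPolynomial (Fin d) ℝ →ₐ[ℝ] C(hull e, ℝ) :=
  MvPolynomial.aeval fun i => ⟨fun x => (x : Pt d) i, by fun_prop⟩

@[simp] lemma polyC_apply (e : Finset (Pt d)) (p : MvPolynomial (Fin d) ℝ) (x : hull e) :
    polyC e p x = pval p x := by
  have : (ContinuousMap.evalAlgHom ℝ ℝ x).comp (polyC e) =
      MvPolynomial.aeval fun i => (x : Pt d) i := by
    refine MvPolynomial.algHom_ext fun i => ?_
    rw [AlgHom.comp_apply, polyC, MvPolynomial.aeval_X, MvPolynomial.aeval_X]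
    rfl
  rw [pval_eq_aeval, ← this]; rfl

/-- Polynomials on a side as continuous functions. -/
def facePolyC (k : ℕ) (e : Finset (Pt d)) : FacePoly k e →ₗ[ℝ] C(hull e, ℝ) where
  toFun φ := ⟨φ.1, continuous_facePoly φ⟩
  map_add' _ _ := rfl
  map_smul' _ _ := rfl

@[simp] lemma facePolyC_apply {k : ℕ} {e : Finset (Pt d)} (φ : FacePoly k e) (x : hull e) :
    facePolyC k e φ x = φ.1 x := rfl

lemma facePolyC_injective (k : ℕ) (e : Finset (Pt d)) : Function.Injective (facePolyC k e) :=
  fun _ _ h => Subtype.ext (congr_arg (fun f : C(hull e, ℝ) => (f : hull e → ℝ)) h)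

instance (k : ℕ) (e : Finset (Pt d)) : FiniteDimensional ℝ (FacePoly k e) := by
  infer_instance

/-! ### The Raviart–Thomas space and its moments. -/

lemma mem_RT {k : ℕ} {r : Fin d → MvPolynomial (Fin d) ℝ} :
    r ∈ RT d k ↔ ∃ p : Fin d → MvPolynomial (Fin d) ℝ, (∀ i, p i ∈ Poly d k) ∧
      ∃ q ∈ Poly d k, ∀ i, r i = p i + MvPolynomial.X i * q := by
  rw [RT, Submodule.mem_sup]
  constructor
  · rintro ⟨p, hp, _, ⟨q, hq, rfl⟩, rfl⟩
    exact ⟨p, fun i => hp i trivial, q, hq, fun i => rfl⟩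
  · rintro ⟨p, hp, q, hq, hr⟩
    exact ⟨p, fun i _ => hp i, _, ⟨q, hq, rfl⟩, funext fun i => (hr i).symm⟩

lemma RT_le {k : ℕ} {r : Fin d → MvPolynomial (Fin d) ℝ} (hr : r ∈ RT d k) (i : Fin d) :
    r i ∈ Poly d (k + 1) := by
  obtain ⟨p, hp, q, hq, h⟩ := mem_RT.1 hr
  rw [h i]
  refine Submodule.add_mem _ (Poly_mono k.le_succ (hp i)) ?_
  rw [add_comm]
  exact mul_mem_Poly (X_mem_Poly i) hq

instance (k : ℕ) : FiniteDimensional ℝ (RT d k) := by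
  let ι : RT d k →ₗ[ℝ] (Fin d → Poly d (k + 1)) :=
    { toFun := fun r i => ⟨r.1 i, RT_le r.2 i⟩
      map_add' := fun _ _ => rfl
      map_smul' := fun _ _ => rfl }
  refine Module.Finite.of_injective ι fun r s h => Subtype.ext (funext fun i => ?_)
  exact congr_arg Subtype.val (congr_fun h i)

/-- Moments of a polynomial field against `[P_l(T)]^d`. -/
def interiorMoment (l : ℕ) (T : Finset (Pt d)) :
    (Fin d → MvPolynomial (Fin d) ℝ) →ₗ[ℝ] Module.Dual ℝ (Fin d → Poly d l) :=
  LinearMap.mk₂ ℝ (fun r w => cellInt T (∑ i, r i * (w i).1))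
    (fun _ _ _ => by simp [add_mul, Finset.sum_add_distrib])
    (fun _ _ _ => by simp [Finset.mul_sum])
    (fun _ _ _ => by simp [mul_add, Finset.sum_add_distrib])
    (fun _ _ _ => by simp [Finset.mul_sum])

/-- Moments of a function on a side against `P_k(e)`. -/
def sideMoment (k : ℕ) (e : Finset (Pt d)) [IsFiniteMeasure (surf e)] :
    C(hull e, ℝ) →ₗ[ℝ] Module.Dual ℝ (FacePoly k e) :=
  LinearMap.mk₂ ℝ (fun f φ => surfInt e (f * facePolyC k e φ))
    (fun _ _ _ => by simp [add_mul])
    (fun _ _ _ => by simp)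
    (fun _ _ _ => by simp [mul_add])
    (fun _ _ _ => by simp)

/-- The component along `n` of a polynomial field, on a side. -/
def dotTrace (n : Pt d) (e : Finset (Pt d)) :
    (Fin d → MvPolynomial (Fin d) ℝ) →ₗ[ℝ] C(hull e, ℝ) :=
  (polyC e).toLinearMap ∘ₗ LinearMap.lsum ℝ (fun _ => MvPolynomial (Fin d) ℝ) ℝ
    (fun i => n i • LinearMap.id)

@[simp] lemma dotTrace_apply (n : Pt d) (e : Finset (Pt d))
    (r : Fin d → MvPolynomial (Fin d) ℝ) (x : hull e) :
    dotTrace n e r x = ∑ i, pval (r i) x * n i := by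
  simp [dotTrace, LinearMap.lsum_apply, mul_comm]

/-! ### Definiteness of integrals over a simplex, and unisolvence. -/

namespace IsSimplex

variable {T : Finset (Pt d)} (h : IsSimplex T)
include h

lemma eqOn_zero_of_setIntegral_eq_zero {F : Pt d → ℝ} (hF : Continuous F)
    (hp : ∀ x ∈ hull T, 0 ≤ F x) (h0 : ∫ x in hull T, F x = 0) : ∀ x ∈ hull T, F x = 0 := by
  have h1 := (setIntegral_eq_zero_iff_of_nonneg_ae
    ((ae_restrict_iff' (measurableSet_hull T)).2 (Filter.Eventually.of_forall hp))
    (hF.continuousOn.integrableOn_compact (isCompact_hull T))).1 h0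
  have h2 := Measure.eqOn_of_ae_eq h1 hF.continuousOn continuousOn_const ?_
  · exact h2
  -- Continuity upgrades almost everywhere to everywhere because the simplex is the closure of its
  -- interior.
  · rw [(convex_convexHull ℝ _).closure_interior_eq_closure_of_nonempty_interior
      ⟨_, h.centroid_mem_interior⟩]
    exact subset_closure

lemma eqOn_zero_of_integral_eq_zero {p : MvPolynomial (Fin d) ℝ}
    (hp : ∀ x ∈ hull T, 0 ≤ pval p x) (h0 : cellInt T p = 0) : ∀ x ∈ hull T, pval p x = 0 :=
  h.eqOn_zero_of_setIntegral_eq_zero (continuous_pval p) hp h0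

lemma eq_zero_of_cellInt_mul_self {p : MvPolynomial (Fin d) ℝ} (h0 : cellInt T (p * p) = 0) :
    p = 0 := by
  refine h.eq_zero_of_pval_hull fun x hx => ?_
  have := h.eqOn_zero_of_integral_eq_zero
    (fun x _ => by rw [pval_mul]; exact mul_self_nonneg _) h0 x hx
  rw [pval_mul] at this
  exact mul_self_eq_zero.1 this

/-- The component of a polynomial field along the gradient of a barycentric coordinate. -/
def gradComp (a : T) (r : Fin d → MvPolynomial (Fin d) ℝ) : MvPolynomial (Fin d) ℝ :=
  ∑ i, MvPolynomial.C (h.grad a i) * r i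

lemma sum_gradComp (r : Fin d → MvPolynomial (Fin d) ℝ) : ∑ a, h.gradComp a r = 0 := by
  simp only [gradComp]
  rw [Finset.sum_comm]
  refine Finset.sum_eq_zero fun i _ => ?_
  rw [← Finset.sum_mul, ← map_sum]
  have : ∑ a, h.grad a i = 0 := by
    have := congr_arg (fun z : Pt d => z i) h.sum_grad
    simpa using this
  rw [this, map_zero, zero_mul]

lemma pval_gradComp (a : T) (r : Fin d → MvPolynomial (Fin d) ℝ) (x : Pt d) :
    pval (h.gradComp a r) x = ⟪h.grad a, WithLp.toLp 2 fun i => pval (r i) x⟫ := by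
  simp [gradComp, PiLp.inner_apply, mul_comm]

/-- The normal component of a field in `RT_k` is a polynomial of degree at most `k` on a side. -/
lemma gradComp_of_RT {p r : Fin d → MvPolynomial (Fin d) ℝ}
    {q : MvPolynomial (Fin d) ℝ} (hr : ∀ i, r i = p i + MvPolynomial.X i * q) (a : T) :
    h.gradComp a r = h.lamPoly a * q +
      (h.gradComp a p - MvPolynomial.C (h.lam a 0) * q) := by
  have : h.gradComp a r = h.gradComp a p + linPoly (h.grad a) * q := by
    simp only [gradComp, hr, linPoly, mul_add, Finset.sum_add_distrib, Finset.sum_mul, mul_assoc]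
  rw [this, lamPoly]; ring

lemma gradComp_mem {k : ℕ} {p : Fin d → MvPolynomial (Fin d) ℝ} (hp : ∀ i, p i ∈ Poly d k)
    (a : T) : h.gradComp a p ∈ Poly d k :=
  Submodule.sum_mem _ fun i _ => C_mul_mem_Poly _ (hp i)

-- The field has degree up to `k + 1`, but `x · n` is constant on a side, so its normal component
-- there has degree at most `k`. It can therefore serve as its own test function in the side
-- moments.
open Classical in
lemma dotTrace_mem_facePoly (hd : 0 < d) {k : ℕ} {r : Fin d → MvPolynomial (Fin d) ℝ}
    (hr : r ∈ RT d k) (a : T) : ∃ φ : FacePoly k (T.erase (a : Pt d)),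
      facePolyC k _ φ = dotTrace (outwardNormal T (T.erase (a : Pt d))) (T.erase (a : Pt d)) r := by
  obtain ⟨p, hp, q, hq, hr⟩ := mem_RT.1 hr
  have hm : h.gradComp a p - MvPolynomial.C (h.lam a 0) * q ∈ Poly d k :=
    Submodule.sub_mem _ (h.gradComp_mem hp a) (C_mul_mem_Poly _ hq)
  refine ⟨-(‖h.grad a‖⁻¹) • ⟨_, restrictPoly_mem hm⟩, ?_⟩
  ext x
  have h1 := congr_arg (fun s => pval s x) (h.gradComp_of_RT hr a)
  have hx : h.lam a x = 0 := (h.mem_hull_erase.1 x.2).2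
  simp only [pval_add, pval_mul, h.pval_lamPoly, hx, zero_mul, zero_add] at h1
  rw [facePolyC_apply, dotTrace_apply]
  simp only [Submodule.coe_smul, Pi.smul_apply, smul_eq_mul]
  rw [restrictPoly_apply, ← h1, h.outwardNormal_erase hd, gradComp, pval_sum, Finset.mul_sum]
  refine Finset.sum_congr rfl fun i _ => ?_
  simp
  ring

open Classical in
/-- Unisolvence of the Raviart--Thomas element. -/
lemma eq_zero_of_moments (hd : 0 < d) {k : ℕ} (hk : 1 ≤ k) {r : Fin d → MvPolynomial (Fin d) ℝ}
    (hr : r ∈ RT d k) (hi : interiorMoment (k - 1) T r = 0)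
    (hs : ∀ (a : T) (φ : FacePoly k (T.erase (a : Pt d))),
      ∫ x, dotTrace (outwardNormal T (T.erase (a : Pt d))) _ r x * φ.1 x
        ∂(surf (T.erase (a : Pt d))) = 0) : r = 0 := by
  obtain ⟨p, hp, q, hq, hrpq⟩ := mem_RT.1 hr
  have hdvd : ∀ a, h.lamPoly a ∣ h.gradComp a r := by
    intro a
    have := h.isFiniteMeasure_surf hd a
    have := h.isOpenPosMeasure_surf hd a
    obtain ⟨φ, hφ⟩ := h.dotTrace_mem_facePoly hd hr a
    -- Test the side moment with the normal trace itself.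
    have h0 : dotTrace (outwardNormal T (T.erase (a : Pt d))) (T.erase (a : Pt d)) r = 0 := by
      refine eq_zero_of_surfInt_mul_self ?_
      have := hs a φ
      rw [← hφ] at this ⊢
      exact this
    refine h.lamPoly_dvd hd a fun x hx => ?_
    have h1 := congr_arg (fun f : C(hull (T.erase (a : Pt d)), ℝ) => f ⟨x, hx⟩) h0
    simp only [dotTrace_apply, h.outwardNormal_erase hd] at h1
    have hg := h.norm_grad_pos hd a
    have : -(‖h.grad a‖⁻¹) * pval (h.gradComp a r) x = 0 := by
      rw [← ContinuousMap.zero_apply (⟨x, hx⟩ : hull (T.erase (a : Pt d))), ← h1, gradComp, pval_sum,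
        Finset.mul_sum]
      refine Finset.sum_congr rfl fun i _ => ?_
      simp
      ring
    exact (mul_eq_zero.1 this).resolve_left (neg_ne_zero.2 (inv_ne_zero hg.ne'))
  choose ψ hψ using hdvd
  -- Modulo degree `k - 1`, every quotient `ψ a` equals the same `q`, the polynomial multiplying `x`
  -- in `r`.
  have hψq : ∀ a, ψ a - q ∈ Poly d (k - 1) := by
    intro a
    refine h.mem_Poly_of_lamPoly_mul hd a ?_
    have : h.lamPoly a * (ψ a - q) = h.gradComp a p - MvPolynomial.C (h.lam a 0) * q := by
      have := h.gradComp_of_RT hrpq a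
      rw [hψ] at this
      rw [mul_sub, this]; ring
    rw [this, Nat.sub_add_cancel hk]
    exact Submodule.sub_mem _ (h.gradComp_mem hp a) (C_mul_mem_Poly _ hq)
  -- Testing with `∑ ψ_a ∇λ_a` would give the desired sum of squares, but its degree is too high.
  -- Subtracting the common `q` lowers the degree, and costs nothing because `∑ ∇λ_a = 0`.
  set w : Fin d → Poly d (k - 1) := fun i =>
    ⟨∑ a, MvPolynomial.C (h.grad a i) * (ψ a - q),
      Submodule.sum_mem _ fun a _ => C_mul_mem_Poly _ (hψq a)⟩ with hw
  have hrw : ∑ i, r i * (w i).1 = ∑ a, h.lamPoly a * (ψ a * ψ a) := by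
    calc _ = ∑ a, (ψ a - q) * h.gradComp a r := by
          simp only [hw, gradComp, Finset.mul_sum]
          rw [Finset.sum_comm]
          exact Finset.sum_congr rfl fun a _ => Finset.sum_congr rfl fun i _ => by ring
      _ = ∑ a, ψ a * h.gradComp a r - q * ∑ a, h.gradComp a r := by
          rw [Finset.mul_sum, ← Finset.sum_sub_distrib]
          exact Finset.sum_congr rfl fun a _ => by ring
      _ = _ := by
          rw [h.sum_gradComp, mul_zero, sub_zero]
          exact Finset.sum_congr rfl fun a _ => by rw [hψ]; ring
  have hnn : ∀ x ∈ hull T, ∀ a, 0 ≤ h.lam a x * (pval (ψ a) x * pval (ψ a) x) := fun x hx a =>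
    mul_nonneg (h.mem_hull.1 hx a) (mul_self_nonneg _)
  have hz := h.eqOn_zero_of_integral_eq_zero (p := ∑ a, h.lamPoly a * (ψ a * ψ a))
    (fun x hx => by
      simp only [pval_sum, pval_mul, h.pval_lamPoly]
      exact Finset.sum_nonneg fun a _ => hnn x hx a)
    (by
      have := DFunLike.congr_fun hi w
      rw [← hrw]; exact this)
  have hψ0 : ∀ a, ψ a = 0 := fun a => by
    refine eq_zero_of_pval_eq_zero isOpen_interior ⟨_, h.centroid_mem_interior⟩ fun x hx => ?_
    have h1 := hz x (interior_subset hx)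
    simp only [pval_sum, pval_mul, h.pval_lamPoly] at h1
    have h2 := (Finset.sum_eq_zero_iff_of_nonneg
      (fun a _ => hnn x (interior_subset hx) a)).1 h1 a (Finset.mem_univ a)
    have h3 := (mul_eq_zero.1 h2).resolve_left (h.mem_interior.1 hx a).ne'
    exact mul_self_eq_zero.1 h3
  funext i
  refine h.eq_zero_of_pval_hull fun x _ => ?_
  -- A vector is determined by its products with the gradients of the barycentric coordinates.
  have h1 : (WithLp.toLp 2 fun i => pval (r i) x : Pt d) = 0 := by
    rw [← h.sum_inner_grad_smul (WithLp.toLp 2 fun i => pval (r i) x)]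
    refine Finset.sum_eq_zero fun a _ => ?_
    rw [← h.pval_gradComp, hψ, hψ0, mul_zero, pval_zero, zero_smul]
  exact congr_arg (fun z : Pt d => z i) h1

end IsSimplex

end WG

namespace WG

variable {d : ℕ}

/-! ### Dimension count -/

instance (k : ℕ) : FiniteDimensional ℝ (MvPolynomial.homogeneousSubmodule (Fin d) ℝ k) := by
  have hle : MvPolynomial.homogeneousSubmodule (Fin d) ℝ k ≤ Poly d k := fun p hp =>
    mem_Poly.2 (MvPolynomial.IsHomogeneous.totalDegree_le hp)
  exact Submodule.finiteDimensional_of_le hle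

/-- The three summands live in degrees at most `k - 1`, exactly `k` and exactly `k + 1`, so they
vanish separately. -/
lemma eq_zero_of_homogeneous_add {k : ℕ} (hk : 1 ≤ k) {p s t : MvPolynomial (Fin d) ℝ}
    (i : Fin d) (hp : p ∈ Poly d (k - 1)) (hs : s.IsHomogeneous k) (ht : t.IsHomogeneous k)
    (h0 : p + s + MvPolynomial.X i * t = 0) : p = 0 ∧ s = 0 ∧ t = 0 := by
  rw [mem_Poly] at hp
  have hXt : (MvPolynomial.X i * t).IsHomogeneous (k + 1) := by
    rw [add_comm]; exact (MvPolynomial.isHomogeneous_X ℝ i).mul ht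
  have ht0 : MvPolynomial.X i * t = 0 := by
    have := congr_arg (MvPolynomial.homogeneousComponent (k + 1)) h0
    rw [map_add, map_add, MvPolynomial.homogeneousComponent_eq_zero _ _ (by omega),
      MvPolynomial.homogeneousComponent_of_mem hs, if_neg (by omega),
      MvPolynomial.homogeneousComponent_of_mem hXt, if_pos rfl] at this
    simpa using this
  rw [ht0, add_zero] at h0
  have hs0 : s = 0 := by
    have := congr_arg (MvPolynomial.homogeneousComponent k) h0
    rw [map_add, MvPolynomial.homogeneousComponent_eq_zero _ _ (by omega),
      MvPolynomial.homogeneousComponent_of_mem hs, if_pos rfl] at this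
    simpa using this
  rw [hs0, add_zero] at h0
  exact ⟨h0, hs0, (mul_eq_zero.1 ht0).resolve_left (MvPolynomial.X_ne_zero i)⟩

/-- `RT_k` contains the direct sum of `[P_{k-1}]^d`, `[H_k]^d` and `x H_k`, where `H_k` denotes the
homogeneous polynomials of degree `k`. A lower bound suffices, since unisolvence bounds the
dimension from above. -/
lemma le_finrank_RT (hd : 0 < d) {k : ℕ} (hk : 1 ≤ k) :
    d * Module.finrank ℝ (Poly d (k - 1)) +
      (d + 1) * Module.finrank ℝ (MvPolynomial.homogeneousSubmodule (Fin d) ℝ k)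
      ≤ Module.finrank ℝ (RT d k) := by
  set H := MvPolynomial.homogeneousSubmodule (Fin d) ℝ k
  have hH : ∀ s : H, (s : MvPolynomial (Fin d) ℝ) ∈ Poly d k := fun s =>
    mem_Poly.2 (MvPolynomial.IsHomogeneous.totalDegree_le s.2)
  let ι : ((Fin d → Poly d (k - 1)) × (Fin d → H)) × H →ₗ[ℝ] RT d k :=
    { toFun := fun x => ⟨fun i => (x.1.1 i).1 + (x.1.2 i).1 + MvPolynomial.X i * x.2.1,
        mem_RT.2 ⟨fun i => (x.1.1 i).1 + (x.1.2 i).1, fun i => Submodule.add_mem _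
          (Poly_mono (Nat.sub_le k 1) (x.1.1 i).2) (hH _), x.2, hH _, fun _ => rfl⟩⟩
      map_add' := fun x y => Subtype.ext (funext fun i => by
        simp only [Prod.fst_add, Prod.snd_add, Pi.add_apply, Submodule.coe_add]
        ring)
      map_smul' := fun c x => Subtype.ext (funext fun i => by
        simp only [Prod.smul_fst, Prod.smul_snd, Pi.smul_apply, Submodule.coe_smul, smul_add,
          RingHom.id_apply, mul_smul_comm]) }
  have hinj : Function.Injective ι := by
    refine (injective_iff_map_eq_zero ι).2 fun x hx => ?_
    have hx' := fun i => eq_zero_of_homogeneous_add hk i (x.1.1 i).2 (x.1.2 i).2 x.2.2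
      (congr_fun (congr_arg Subtype.val hx) i)
    refine Prod.ext (Prod.ext (funext fun i => Subtype.ext (hx' i).1)
      (funext fun i => Subtype.ext (hx' i).2.1)) (Subtype.ext (hx' ⟨0, hd⟩).2.2)
  refine le_trans (le_of_eq ?_) (LinearMap.finrank_le_finrank_of_injective hinj)
  rw [Module.finrank_prod, Module.finrank_prod, Module.finrank_pi_fintype,
    Module.finrank_pi_fintype]
  simp
  ring

/-! ### Dimension of the side polynomials; bijectivity of the moments. -/

namespace IsSimplex

variable {T : Finset (Pt d)} (h : IsSimplex T)
include h

-- On a side, every polynomial of degree at most `k` is a homogeneous polynomial of degree `k` in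
-- the `d` barycentric coordinates of the side. This bounds the dimension without an explicit
-- parametrization or binomial coefficients.
open Classical in
lemma finrank_facePoly_le (k : ℕ) (a : T) :
    Module.finrank ℝ (FacePoly k (T.erase (a : Pt d))) ≤
      Module.finrank ℝ (MvPolynomial.homogeneousSubmodule (Fin d) ℝ k) := by
  have hcard : Fintype.card {b : T // b ≠ a} = d := by
    rw [Fintype.card_subtype_compl, Fintype.card_coe, h.card]; simp
  let v : Fin d ≃ {b : T // b ≠ a} := (Fintype.equivFinOfCardEq hcard).symm
  let ev : MvPolynomial (Fin d) ℝ →ₗ[ℝ] (hull (T.erase (a : Pt d)) → ℝ) :=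
    LinearMap.pi fun x => (MvPolynomial.aeval fun j => h.lam (v j).1 x).toLinearMap
  have hsum : ∀ (x : hull (T.erase (a : Pt d))) (c : T → ℝ),
      ∑ j, h.lam (v j).1 x * c (v j).1 = ∑ b, h.lam b x * c b := by
    intro x c
    have hx : h.lam a x = 0 := (h.mem_hull_erase.1 x.2).2
    rw [Equiv.sum_comp v (fun b => h.lam b.1 x * c b.1),
      Fintype.sum_eq_add_sum_subtype_ne (fun b => h.lam b x * c b) a, hx, zero_mul, zero_add]
  have hle : FacePoly k (T.erase (a : Pt d)) ≤
      (MvPolynomial.homogeneousSubmodule (Fin d) ℝ k).map ev := by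
    rintro _ ⟨p, hp, rfl⟩
    have hp' : p.totalDegree ≤ k := mem_Poly.1 hp
    let L : Fin d → MvPolynomial (Fin d) ℝ := fun i =>
      ∑ j, MvPolynomial.C (((v j).1 : Pt d) i) * MvPolynomial.X j
    let S : MvPolynomial (Fin d) ℝ := ∑ j, MvPolynomial.X j
    have hL : ∀ i, (L i).IsHomogeneous 1 := fun i =>
      MvPolynomial.IsHomogeneous.sum _ _ _ fun j _ => MvPolynomial.isHomogeneous_C_mul_X _ _
    have hS : S.IsHomogeneous 1 :=
      MvPolynomial.IsHomogeneous.sum _ _ _ fun j _ => MvPolynomial.isHomogeneous_X _ _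
    -- `L i` represents the coordinate `x i`, and `S` represents `1` on the side; powers of `S`
    -- raise each monomial to degree exactly `k`.
    refine ⟨∑ m ∈ p.support, MvPolynomial.C (p.coeff m) *
      ((∏ i, L i ^ m i) * S ^ (k - ∑ i, m i)), ?_, ?_⟩
    · refine MvPolynomial.IsHomogeneous.sum _ _ _ fun m hm => MvPolynomial.IsHomogeneous.C_mul ?_ _
      have h1 : ∑ i, m i ≤ k := by
        refine le_trans ?_ ((MvPolynomial.le_totalDegree hm).trans hp')
        rw [Finsupp.sum_fintype _ _ fun _ => rfl]
      have h2 : (∏ i, L i ^ m i).IsHomogeneous (∑ i, m i) :=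
        MvPolynomial.IsHomogeneous.prod _ _ _ fun i _ => by simpa using (hL i).pow (m i)
      have h3 := h2.mul (hS.pow (k - ∑ i, m i))
      rwa [one_mul, Nat.add_sub_cancel' h1] at h3
    · ext x
      have hLx : ∀ i, MvPolynomial.aeval (fun j => h.lam (v j).1 x) (L i) = (x : Pt d) i := by
        intro i
        have h1 := hsum x fun b => (b : Pt d) i
        have h2 := congr_arg (fun z : Pt d => z i) (h.sum_lam_smul x)
        simp only [WithLp.ofLp_sum, WithLp.ofLp_smul, Finset.sum_apply, Pi.smul_apply,
          smul_eq_mul] at h2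
        rw [← h2, ← h1]
        simp [L, mul_comm]
      have hSx : MvPolynomial.aeval (fun j => h.lam (v j).1 x) S = (1 : ℝ) := by
        have h1 := hsum x fun _ => 1
        simp only [mul_one, h.sum_lam] at h1
        simpa [S] using h1
      rw [restrictPoly_apply]
      change MvPolynomial.aeval (fun j => h.lam (v j).1 x) _ = _
      rw [map_sum, pval, MvPolynomial.eval_eq']
      refine Finset.sum_congr rfl fun m _ => ?_
      rw [map_mul, map_mul, map_pow, hSx, one_pow, mul_one, map_prod]
      simp only [map_pow, hLx, MvPolynomial.aeval_C]
      rfl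
  exact (Submodule.finrank_mono hle).trans (Submodule.finrank_map_le _ _)

open Classical in
/-- The degrees of freedom of the Raviart--Thomas element. -/
def moments (hd : 0 < d) (k : ℕ) : RT d k →ₗ[ℝ] Module.Dual ℝ (Fin d → Poly d (k - 1)) ×
    ((a : T) → Module.Dual ℝ (FacePoly k (T.erase (a : Pt d)))) :=
  ((interiorMoment (k - 1) T).prod (LinearMap.pi fun a =>
    haveI := h.isFiniteMeasure_surf hd a
    sideMoment k (T.erase (a : Pt d)) ∘ₗ dotTrace (outwardNormal T (T.erase (a : Pt d))) _)) ∘ₗ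
    (RT d k).subtype

lemma moments_injective (hd : 0 < d) {k : ℕ} (hk : 1 ≤ k) :
    Function.Injective (h.moments hd k) := by
  refine (injective_iff_map_eq_zero _).2 fun r hr => Subtype.ext ?_
  have h1 := congr_arg Prod.fst hr
  have h2 := congr_arg Prod.snd hr
  exact h.eq_zero_of_moments hd hk r.2 h1 fun a φ => DFunLike.congr_fun (congr_fun h2 a) φ

open Classical in
/-- The Raviart--Thomas degrees of freedom as an equivalence. -/
def momentEquiv (hd : 0 < d) {k : ℕ} (hk : 1 ≤ k) : RT d k ≃ₗ[ℝ]
    Module.Dual ℝ (Fin d → Poly d (k - 1)) ×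
    ((a : T) → Module.Dual ℝ (FacePoly k (T.erase (a : Pt d)))) :=
  LinearMap.linearEquivOfInjective (h.moments hd k) (h.moments_injective hd hk) (by
    -- The `d + 1` sides contribute at most `dim H_k` each, which with the interior moments matches
    -- the lower bound for `dim RT_k`.
    refine le_antisymm
      (LinearMap.finrank_le_finrank_of_injective (h.moments_injective hd hk))
      (le_trans ?_ (le_finrank_RT hd hk))
    rw [Module.finrank_prod, Module.finrank_pi_fintype, Subspace.dual_finrank_eq,
      Module.finrank_pi_fintype]
    simp only [Subspace.dual_finrank_eq]
    refine add_le_add (by simp) ((Finset.sum_le_sum fun a _ => h.finrank_facePoly_le k a).trans ?_)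
    simp [h.card])

lemma momentEquiv_apply (hd : 0 < d) {k : ℕ} (hk : 1 ≤ k) (r : RT d k) :
    h.momentEquiv hd hk r = h.moments hd k r := rfl

end IsSimplex

end WG

/-! ### Elements and sides of a simplicial partition -/

namespace WG

variable {d : ℕ}

namespace IsSimplex

variable {T : Finset (Pt d)} (h : IsSimplex T)
include h

lemma exists_erase_eq {e : Finset (Pt d)} [DecidableEq (Pt d)] (he : e ⊆ T) (hc : e.card = d) :
    ∃ a : T, T.erase (a : Pt d) = e := by
  have h1 : (T \ e).card = 1 := by rw [Finset.card_sdiff_of_subset he, h.card, hc]; omega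
  obtain ⟨a, ha⟩ := Finset.card_eq_one.1 h1
  have haT : a ∈ T \ e := by rw [ha]; simp
  refine ⟨⟨a, (Finset.mem_sdiff.1 haT).1⟩, ?_⟩
  rw [Finset.erase_eq, ← ha, Finset.sdiff_sdiff_eq_self he]

open Classical in
/-- The gradients belonging to a common side are parallel. -/
lemma grad_parallel (hd : 0 < d) {T' : Finset (Pt d)} (h' : IsSimplex T') (a : T) (b : T')
    (hab : T.erase (a : Pt d) = T'.erase (b : Pt d)) :
    ∃ c : ℝ, c ≠ 0 ∧ h'.grad b = c • h.grad a := by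
  have h1 := h.vectorSpan_erase hd a
  rw [hab, h'.vectorSpan_erase hd b] at h1
  have h2 := congr_arg (fun K : Submodule ℝ (Pt d) => Kᗮ) h1
  simp only [Submodule.orthogonal_orthogonal] at h2
  have h3 : h'.grad b ∈ ℝ ∙ h.grad a := by
    rw [← h2]; exact Submodule.mem_span_singleton_self _
  obtain ⟨c, hc⟩ := Submodule.mem_span_singleton.1 h3
  refine ⟨c, ?_, hc.symm⟩
  rintro rfl
  rw [zero_smul] at hc
  exact h'.grad_ne_zero hd b hc.symm

open Classical in
/-- Moving from the barycenter of a side into the simplex. -/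
lemma eventually_mem_interior (hd : 0 < d) (a : T) {n : Pt d} (hn : 0 < ⟪h.grad a, n⟫) :
    ∀ᶠ t in nhdsWithin (0 : ℝ) (Set.Ioi 0),
      (T.erase (a : Pt d)).centroid ℝ id + t • n ∈ interior (hull T) := by
  set c := (T.erase (a : Pt d)).centroid ℝ id
  have hTs : T.erase (a : Pt d) ⊆ T := Finset.erase_subset _ _
  have : ∀ᶠ t in nhdsWithin (0 : ℝ) (Set.Ioi 0), ∀ b, 0 < h.lam b (c + t • n) := by
    refine Filter.eventually_all.2 fun b => ?_
    by_cases hb : b = a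
    · filter_upwards [self_mem_nhdsWithin] with t ht
      rw [hb, h.lam_eq a _ c, h.lam_centroid_of_notMem hTs (h.nonempty_of_pos hd a) a (by simp),
        add_sub_cancel_left, inner_smul_right, zero_add]
      exact mul_pos ht hn
    · have hbm : (b : Pt d) ∈ T.erase (a : Pt d) :=
        Finset.mem_erase.2 ⟨fun hba => hb (Subtype.ext hba), b.2⟩
      have hpos : 0 < h.lam b c := by
        rw [h.lam_centroid hTs b hbm]
        have : 0 < (T.erase (a : Pt d)).card := Finset.card_pos.2 ⟨_, hbm⟩
        positivity
      have hcont : Continuous fun t : ℝ => h.lam b (c + t • n) :=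
        (h.continuous_lam b).comp (by fun_prop)
      have := hcont.tendsto' 0 (h.lam b c) (by simp)
      exact (this.mono_left nhdsWithin_le_nhds).eventually (lt_mem_nhds hpos)
  filter_upwards [this] with t ht
  exact h.mem_interior.2 ht

end IsSimplex

/-! ### Incidence of cells and faces. -/

namespace SimplicialPartition

variable {Ω : Set (Pt d)} {𝒯 : SimplicialPartition Ω}

lemma isSimplex (T : 𝒯.Cell) : IsSimplex T.1 := ⟨𝒯.indep T.2.1, T.2.2⟩

open Classical in
/-- The side of `T` opposite to the vertex `a`. -/
def sideOf (hd : 0 < d) (T : 𝒯.Cell) (a : T.1) : 𝒯.Face :=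
  ⟨T.1.erase a, 𝒯.down_closed T.2.1 (Finset.erase_subset _ _) ((isSimplex T).nonempty_of_pos hd a),
    by rw [Finset.card_erase_of_mem a.2, T.2.2]; rfl⟩

lemma mem_sides {T : 𝒯.Cell} {e : 𝒯.Face} : e ∈ 𝒯.sides T ↔ e.1 ⊆ T.1 := by
  simp [sides]

lemma sideOf_mem_sides (hd : 0 < d) (T : 𝒯.Cell) (a : T.1) : sideOf hd T a ∈ 𝒯.sides T :=
  mem_sides.2 (Finset.erase_subset _ _)

lemma exists_sideOf (hd : 0 < d) {T : 𝒯.Cell} {e : 𝒯.Face} (he : e ∈ 𝒯.sides T) :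
    ∃ a, e = sideOf hd T a := by
  classical
  obtain ⟨a, ha⟩ := (isSimplex T).exists_erase_eq (mem_sides.1 he) e.2.2
  refine ⟨a, Subtype.ext ?_⟩
  rw [← ha, sideOf]

lemma sideOf_injective (hd : 0 < d) (T : 𝒯.Cell) : Function.Injective (sideOf hd T) := by
  intro a b hab
  by_contra hne
  have h1 : (b : Pt d) ∈ (sideOf hd T a).1 :=
    Finset.mem_erase.2 ⟨fun h => hne (Subtype.ext h.symm), b.2⟩
  rw [hab] at h1
  exact (Finset.mem_erase.1 h1).1 rfl

lemma sum_sides {M : Type*} [AddCommMonoid M] (hd : 0 < d) (T : 𝒯.Cell) (f : 𝒯.Face → M) :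
    ∑ e ∈ 𝒯.sides T, f e = ∑ a, f (sideOf hd T a) := by
  classical
  have : 𝒯.sides T = Finset.univ.image (sideOf hd T) := by
    ext e
    refine ⟨fun he => ?_, fun he => ?_⟩
    · obtain ⟨a, rfl⟩ := exists_sideOf hd he
      exact Finset.mem_image_of_mem _ (Finset.mem_univ a)
    · obtain ⟨a, -, rfl⟩ := Finset.mem_image.1 he
      exact sideOf_mem_sides hd T a
  rw [this, Finset.sum_image fun a _ b _ hab => sideOf_injective hd T hab]

lemma exists_cell_of_face (e : 𝒯.Face) : ∃ T : 𝒯.Cell, e ∈ 𝒯.sides T := by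
  obtain ⟨T, hT, heT, hc⟩ := 𝒯.exists_cell e.1 e.2.1
  exact ⟨⟨T, hT, hc⟩, mem_sides.2 heT⟩

/-- By conformity the point lies in the hull of the common vertices. All its coordinates in `T₁` are
positive, so every vertex of `T₁` is common. -/
lemma eq_of_mem_interior {T₁ T₂ : 𝒯.Cell} {x : Pt d} (h1 : x ∈ interior (hull T₁.1))
    (h2 : x ∈ hull T₂.1) : T₁ = T₂ := by
  classical
  have hx := 𝒯.inter_subset_convexHull T₁.2.1 T₂.2.1 ⟨interior_subset h1, h2⟩
  have hx' : x ∈ hull (T₁.1 ∩ T₂.1) := by simpa [hull] using hx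
  have h3 := ((isSimplex T₁).mem_hull_of_subset Finset.inter_subset_left).1 hx'
  have hsub : T₁.1 ⊆ T₂.1 := fun a ha => by
    by_contra hn
    have := h3.2 ⟨a, ha⟩ fun hh => hn (Finset.mem_inter.1 hh).2
    exact ((isSimplex T₁).mem_interior.1 h1 ⟨a, ha⟩).ne' this
  exact Subtype.ext (Finset.eq_of_subset_of_card_le hsub (by rw [T₁.2.2, T₂.2.2]))

lemma exists_cell_of_mem_closure {x : Pt d} (hx : x ∈ closure Ω) : ∃ T : 𝒯.Cell, x ∈ hull T.1 := by
  rw [← 𝒯.cover] at hx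
  obtain ⟨s, hs, hxs⟩ := Set.mem_iUnion₂.1 hx
  obtain ⟨T, hT, hsT, hc⟩ := 𝒯.exists_cell s hs
  exact ⟨⟨T, hT, hc⟩, convexHull_mono (by exact_mod_cast hsT) hxs⟩

lemma hull_subset_closure {s : Finset (Pt d)} (hs : s ∈ 𝒯.faces) : hull s ⊆ closure Ω := by
  rw [← 𝒯.cover]
  exact Set.subset_biUnion_of_mem (u := fun s : Finset (Pt d) => convexHull ℝ (s : Set (Pt d))) hs

open Classical in
/-- There is at most one cell on each side of a face. -/
lemma sideOf_unique (hd : 0 < d) {T₁ T₂ : 𝒯.Cell} {a : T₁.1} {b : T₂.1}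
    (hab : T₁.1.erase (a : Pt d) = T₂.1.erase (b : Pt d)) {n : Pt d}
    (h1 : 0 < ⟪(isSimplex T₁).grad a, n⟫) (h2 : 0 < ⟪(isSimplex T₂).grad b, n⟫) : T₁ = T₂ := by
  -- Starting at the barycenter of the common side, a short step along `n` enters the interiors of
  -- both cells.
  have e1 := (isSimplex T₁).eventually_mem_interior hd a h1
  have e2 := (isSimplex T₂).eventually_mem_interior hd b h2
  rw [← hab] at e2
  obtain ⟨t, ht1, ht2⟩ := (e1.and e2).exists
  exact eq_of_mem_interior ht1 (interior_subset ht2)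

-- A point of the side in `Ω` is moved slightly towards the barycenter. Positivity of its
-- coordinates is what forces a cell containing it to contain the whole side.
open Classical in
lemma exists_mem_relInterior (hd : 0 < d) (hΩ : IsOpen Ω) (T : 𝒯.Cell) (a : T.1)
    (hb : ¬ OnBoundary Ω (T.1.erase (a : Pt d))) :
    ∃ x ∈ Ω, x ∈ hull (T.1.erase (a : Pt d)) ∧ ∀ b, b ≠ a → 0 < (isSimplex T).lam b x := by
  set h := isSimplex T
  obtain ⟨y, hy, hyf⟩ := Set.not_subset.1 hb
  have hyΩ : y ∈ Ω := by
    have h1 := hull_subset_closure (sideOf hd T a).2.1 hy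
    rw [closure_eq_self_union_frontier] at h1
    exact h1.resolve_right hyf
  set c := (T.1.erase (a : Pt d)).centroid ℝ id
  have hTs : T.1.erase (a : Pt d) ⊆ T.1 := Finset.erase_subset _ _
  have hcont : Continuous fun t : ℝ => y + t • (c - y) := by fun_prop
  have : ∀ᶠ t in nhdsWithin (0 : ℝ) (Set.Ioi 0), y + t • (c - y) ∈ Ω :=
    ((hcont.tendsto' 0 y (by simp)).mono_left nhdsWithin_le_nhds).eventually (hΩ.mem_nhds hyΩ)
  obtain ⟨t, htΩ, ht0, ht1⟩ := (this.and (Ioo_mem_nhdsGT one_pos)).exists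
  have hc : c ∈ hull (T.1.erase (a : Pt d)) :=
    Finset.centroid_mem_convexHull (R := ℝ) _ (h.nonempty_of_pos hd a)
  refine ⟨_, htΩ, ?_, fun b hb => ?_⟩
  · exact (convex_convexHull ℝ _).add_smul_sub_mem hy hc ⟨ht0.le, ht1.le⟩
  · have hbm : (b : Pt d) ∈ T.1.erase (a : Pt d) :=
      Finset.mem_erase.2 ⟨fun hba => hb (Subtype.ext hba), b.2⟩
    have hpos : 0 < h.lam b c := by
      rw [h.lam_centroid hTs b hbm]
      have : 0 < (T.1.erase (a : Pt d)).card := Finset.card_pos.2 ⟨_, hbm⟩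
      positivity
    have hyb := h.mem_hull.1 (h.mem_hull_erase.1 hy).1 b
    rw [h.lam_eq b _ y, add_sub_cancel_left, inner_smul_right, ← h.lam_sub]
    nlinarith [mul_pos ht0 hpos, mul_nonneg (sub_nonneg.2 ht1.le) hyb]

open Classical in
/-- There is a cell on each side of an interior face. -/
lemma exists_sideOf_pos (hd : 0 < d) (hΩ : IsOpen Ω) (T : 𝒯.Cell) (a : T.1)
    (hb : ¬ OnBoundary Ω (T.1.erase (a : Pt d))) {σ : ℝ} (hσ : σ ≠ 0) :
    ∃ (T' : 𝒯.Cell) (b : T'.1), T'.1.erase (b : Pt d) = T.1.erase (a : Pt d) ∧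
      0 < ⟪(isSimplex T').grad b, σ • (isSimplex T).grad a⟫ := by
  set h := isSimplex T with hh
  set n := σ • h.grad a with hn
  obtain ⟨x, hxΩ, hxe, hxpos⟩ := exists_mem_relInterior hd hΩ T a hb
  have hcont : Continuous fun t : ℝ => x + t • n := by fun_prop
  have hlim := (hcont.tendsto' 0 x (by simp)).mono_left
    (nhdsWithin_le_nhds (s := Set.Ioi (0 : ℝ)))
  -- The points `x + t • n` stay in `Ω` for small `t` and are covered by finitely many cells, so a
  -- single cell contains them for arbitrarily small `t > 0`; being closed, it also contains `x`.
  have hex : ∃ T' : 𝒯.Cell, ∃ᶠ t in nhdsWithin (0 : ℝ) (Set.Ioi 0), x + t • n ∈ hull T'.1 := by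
    by_contra hno
    push Not at hno
    have h1 := Filter.eventually_all.2 hno
    obtain ⟨t, ht1, ht2⟩ := (h1.and (hlim.eventually (hΩ.mem_nhds hxΩ))).exists
    obtain ⟨T', hT'⟩ := exists_cell_of_mem_closure (𝒯 := 𝒯) (subset_closure ht2)
    exact ht1 T' hT'
  obtain ⟨T', hfreq⟩ := hex
  set h' := isSimplex T' with hh'
  have hxT' : x ∈ hull T'.1 :=
    (isCompact_hull T'.1).isClosed.mem_of_frequently_of_tendsto hfreq hlim
  -- By conformity `x` lies in the hull of the vertices common to the side and `T'`; since `x` is in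
  -- the relative interior of the side, no vertex of the side can be missing.
  have hsub : T.1.erase (a : Pt d) ⊆ T'.1 := by
    have h1 := 𝒯.inter_subset_convexHull (sideOf hd T a).2.1 T'.2.1 ⟨hxe, hxT'⟩
    have h2 : x ∈ hull (T.1.erase (a : Pt d) ∩ T'.1) := by
      rw [hull, Finset.coe_inter]; exact h1
    have h3 := (h.mem_hull_of_subset
      (Finset.inter_subset_left.trans (Finset.erase_subset _ _))).1 h2
    intro b hbe
    obtain ⟨hba, hbT⟩ := Finset.mem_erase.1 hbe
    by_contra hbT'
    have h4 := h3.2 ⟨b, hbT⟩ fun hm => hbT' (Finset.mem_inter.1 hm).2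
    exact (hxpos ⟨b, hbT⟩ fun hba' => hba (congr_arg Subtype.val hba')).ne' h4
  obtain ⟨b, hbe⟩ := h'.exists_erase_eq hsub (sideOf hd T a).2.2
  refine ⟨T', b, hbe, ?_⟩
  obtain ⟨c, hc0, hc⟩ := h.grad_parallel hd h' a b hbe.symm
  -- The pairing is nonzero because the two gradients are parallel, and nonnegative because `λ_b` is
  -- zero at `x` and nonnegative at points `x + t • n` of `T'`.
  have hne : ⟪h'.grad b, n⟫ ≠ 0 := by
    rw [hc, hn, inner_smul_left, inner_smul_right, real_inner_self_eq_norm_sq]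
    have := h.norm_grad_pos hd a
    simp only [conj_trivial]
    positivity
  refine lt_of_le_of_ne ?_ hne.symm
  obtain ⟨t, ht, ht0⟩ := (hfreq.and_eventually self_mem_nhdsWithin).exists
  have hxb : h'.lam b x = 0 := (h'.mem_hull_erase.1 (hbe ▸ hxe)).2
  have h5 := h'.mem_hull.1 ht b
  rw [h'.lam_eq b _ x, hxb, add_sub_cancel_left, inner_smul_right, zero_add] at h5
  exact nonneg_of_mul_nonneg_right h5 ht0

-- The gradients are parallel with a factor of the same sign as `σ`, and normalization removes its
-- modulus.
open Classical in
lemma outwardNormal_eq (hd : 0 < d) {T T' : 𝒯.Cell} {a : T.1} {b : T'.1}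
    (hab : T'.1.erase (b : Pt d) = T.1.erase (a : Pt d)) {σ : ℝ}
    (hpos : 0 < ⟪(isSimplex T').grad b, σ • (isSimplex T).grad a⟫) (hσ : |σ| = 1) :
    outwardNormal T'.1 (T'.1.erase (b : Pt d))
      = σ • outwardNormal T.1 (T.1.erase (a : Pt d)) := by
  set h := isSimplex T
  set h' := isSimplex T'
  obtain ⟨c, hc0, hc⟩ := h.grad_parallel hd h' a b hab.symm
  have hg := h.norm_grad_pos hd a
  rw [hc, inner_smul_left, inner_smul_right, real_inner_self_eq_norm_sq] at hpos
  simp only [conj_trivial] at hpos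
  have hcσ : 0 < c * σ := by
    have : 0 < (c * σ) * ‖h.grad a‖ ^ 2 := by linarith
    exact pos_of_mul_pos_left this (by positivity)
  rw [h'.outwardNormal_erase hd, h.outwardNormal_erase hd, hc, norm_smul, Real.norm_eq_abs,
    smul_neg, smul_smul, smul_smul]
  congr 2
  have habs : |c| = c * σ := by
    rw [← abs_of_pos hcσ, abs_mul, hσ, mul_one]
  have hσ2 : σ * σ = 1 := by rw [← abs_mul_abs_self, hσ, one_mul]
  rw [habs]
  have hc' : σ ≠ 0 := fun h0 => by rw [h0] at hσ; simp at hσ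
  field_simp
  rw [sq, hσ2]

/-- An interior face has exactly one cell on each side. -/
theorem exists_pair (hd : 0 < d) (hΩ : IsOpen Ω) (e : 𝒯.Face) (hb : ¬ OnBoundary Ω e.1) :
    ∃ T₁ T₂ : 𝒯.Cell, T₁ ≠ T₂ ∧ (∀ T, e ∈ 𝒯.sides T ↔ T = T₁ ∨ T = T₂) ∧
      outwardNormal T₂.1 e.1 = -outwardNormal T₁.1 e.1 := by
  classical
  obtain ⟨T, hT⟩ := exists_cell_of_face e
  obtain ⟨a, rfl⟩ := exists_sideOf hd hT
  have hgg : 0 < ⟪(isSimplex T).grad a, (isSimplex T).grad a⟫ := by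
    rw [real_inner_self_eq_norm_sq]
    have := (isSimplex T).norm_grad_pos hd a
    positivity
  -- `σ = -1` asks for a cell on the side of the face away from `T`.
  obtain ⟨T', b, hbe, hpos⟩ := exists_sideOf_pos hd hΩ T a hb (σ := -1) (by norm_num)
  have hn := outwardNormal_eq hd hbe hpos (by norm_num)
  rw [hbe, neg_one_smul] at hn
  rw [neg_one_smul, inner_neg_right] at hpos
  refine ⟨T, T', ?_, fun S => ⟨fun hS => ?_, ?_⟩, hn⟩
  · rintro rfl
    have : a = b := by
      apply sideOf_injective hd T
      exact Subtype.ext hbe.symm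
    rw [← this] at hpos
    linarith
  · obtain ⟨s, hs⟩ := exists_sideOf hd hS
    have hse : S.1.erase (s : Pt d) = T.1.erase (a : Pt d) := (congr_arg Subtype.val hs).symm
    obtain ⟨c, hc0, hc⟩ := (isSimplex T).grad_parallel hd (isSimplex S) a s hse.symm
    -- The sign of the factor tells on which side of the face `S` lies, and each side has only one
    -- cell.
    rcases lt_or_gt_of_ne hc0 with hneg | hp
    · right
      refine sideOf_unique hd (hse.trans hbe.symm) (n := -(isSimplex T).grad a) ?_ ?_
      · rw [hc, inner_neg_right, inner_smul_left, conj_trivial, ← neg_mul]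
        exact mul_pos (neg_pos.2 hneg) hgg
      · rwa [inner_neg_right]
    · left
      refine sideOf_unique hd hse (n := (isSimplex T).grad a) ?_ hgg
      rw [hc, inner_smul_left, conj_trivial]
      exact mul_pos hp hgg
  · rintro (rfl | rfl)
    · exact hT
    · refine mem_sides.2 ?_
      change T.1.erase (a : Pt d) ⊆ S.1
      rw [← hbe]
      exact Finset.erase_subset _ _

/-- A sum of side contributions vanishes if those of boundary faces vanish and those of the two
cells at an interior face cancel. -/
lemma sum_sides_eq_zero (hd : 0 < d) (hΩ : IsOpen Ω) (f : 𝒯.Cell → 𝒯.Face → ℝ)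
    (hb : ∀ T, ∀ e ∈ 𝒯.sides T, OnBoundary Ω e.1 → f T e = 0)
    (hi : ∀ T₁ T₂ e, e ∈ 𝒯.sides T₁ → e ∈ 𝒯.sides T₂ →
      outwardNormal T₂.1 e.1 = -outwardNormal T₁.1 e.1 → f T₁ e + f T₂ e = 0) :
    ∑ T, ∑ e ∈ 𝒯.sides T, f T e = 0 := by
  classical
  rw [Finset.sum_comm' (s' := fun e => Finset.univ.filter fun T => e ∈ 𝒯.sides T)
    (t' := Finset.univ) (by simp)]
  refine Finset.sum_eq_zero fun e _ => ?_
  by_cases hbe : OnBoundary Ω e.1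
  · exact Finset.sum_eq_zero fun T hT => hb T e (by simpa using hT) hbe
  · obtain ⟨T₁, T₂, hne, hiff, hn⟩ := exists_pair hd hΩ e hbe
    have : (Finset.univ.filter fun T => e ∈ 𝒯.sides T) = {T₁, T₂} := by
      ext T; simp [hiff]
    rw [this, Finset.sum_pair hne]
    exact hi T₁ T₂ e ((hiff _).2 (Or.inl rfl)) ((hiff _).2 (Or.inr rfl)) hn

end SimplicialPartition

end WG

namespace WG

variable {d : ℕ}

/-! ### Representation of linear functionals -/

/-- A definite bilinear form on a finite-dimensional space identifies the space with its dual. -/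
def rieszEquiv {V : Type*} [AddCommGroup V] [Module ℝ V] [FiniteDimensional ℝ V]
    (B : V →ₗ[ℝ] Module.Dual ℝ V) (hB : ∀ v, B v v = 0 → v = 0) : V ≃ₗ[ℝ] Module.Dual ℝ V :=
  LinearMap.linearEquivOfInjective B
    ((injective_iff_map_eq_zero B).2 fun v hv => hB v (by rw [hv]; rfl))
    Subspace.dual_finrank_eq.symm

lemma rieszEquiv_apply {V : Type*} [AddCommGroup V] [Module ℝ V] [FiniteDimensional ℝ V]
    (B : V →ₗ[ℝ] Module.Dual ℝ V) (hB : ∀ v, B v v = 0 → v = 0) (v : V) :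
    rieszEquiv B hB v = B v := rfl

lemma eq_rieszEquiv_symm {V : Type*} [AddCommGroup V] [Module ℝ V] [FiniteDimensional ℝ V]
    {B : V →ₗ[ℝ] Module.Dual ℝ V} {hB : ∀ v, B v v = 0 → v = 0} {v : V} {L : Module.Dual ℝ V} :
    v = (rieszEquiv B hB).symm L ↔ ∀ w, B v w = L w := by
  rw [LinearEquiv.eq_symm_apply, rieszEquiv_apply]
  exact LinearMap.ext_iff

variable {Ω : Set (Pt d)} {𝒯 : SimplicialPartition Ω} {k : ℕ}

open SimplicialPartition

instance [NeZero d] (e : 𝒯.Face) : IsFiniteMeasure (surf e.1) := by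
  obtain ⟨T, hT⟩ := exists_cell_of_face e
  obtain ⟨a, rfl⟩ := exists_sideOf (NeZero.pos d) hT
  exact (isSimplex T).isFiniteMeasure_surf (NeZero.pos d) a

instance [NeZero d] (e : 𝒯.Face) : (surf e.1).IsOpenPosMeasure := by
  obtain ⟨T, hT⟩ := exists_cell_of_face e
  obtain ⟨a, rfl⟩ := exists_sideOf (NeZero.pos d) hT
  exact (isSimplex T).isOpenPosMeasure_surf (NeZero.pos d) a

/-! ### Weak gradient -/

/-- The `L²(T)` inner product of matrices of polynomials. -/
def matrixForm (l : ℕ) (T : Finset (Pt d)) : Matrix (Fin d) (Fin d) (Poly d l) →ₗ[ℝ]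
    Module.Dual ℝ (Matrix (Fin d) (Fin d) (Poly d l)) :=
  LinearMap.mk₂ ℝ (fun G φ => cellInt T (∑ i, ∑ j, (G i j).1 * (φ i j).1))
    (fun _ _ _ => by simp [add_mul, Finset.sum_add_distrib])
    (fun _ _ _ => by simp [Finset.mul_sum])
    (fun _ _ _ => by simp [mul_add, Finset.sum_add_distrib])
    (fun _ _ _ => by simp [Finset.mul_sum])

lemma matrixForm_apply (l : ℕ) (T : Finset (Pt d)) (G φ : Matrix (Fin d) (Fin d) (Poly d l)) :
    matrixForm l T G φ = cellInt T (∑ i, ∑ j, (G i j).1 * (φ i j).1) := rfl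

lemma matrixForm_nonneg (l : ℕ) (T : Finset (Pt d)) (G : Matrix (Fin d) (Fin d) (Poly d l)) :
    0 ≤ matrixForm l T G G := by
  rw [matrixForm_apply, map_sum]
  refine Finset.sum_nonneg fun i _ => ?_
  rw [map_sum]
  exact Finset.sum_nonneg fun j _ => cellInt_mul_self_nonneg T _

lemma IsSimplex.matrixForm_definite {T : Finset (Pt d)} (h : IsSimplex T) (l : ℕ)
    (G : Matrix (Fin d) (Fin d) (Poly d l)) (h0 : matrixForm l T G G = 0) : G = 0 := by
  rw [matrixForm_apply, map_sum] at h0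
  simp_rw [map_sum] at h0
  have h1 := (Finset.sum_eq_zero_iff_of_nonneg fun i _ => Finset.sum_nonneg fun j _ =>
    cellInt_mul_self_nonneg T _).1 h0
  ext1 i j
  have h2 := (Finset.sum_eq_zero_iff_of_nonneg fun j _ =>
    cellInt_mul_self_nonneg T _).1 (h1 i (Finset.mem_univ i)) j (Finset.mem_univ j)
  exact Subtype.ext (h.eq_zero_of_cellInt_mul_self h2)

/-- The `L²(T)` inner product of polynomials. -/
def polyForm (l : ℕ) (T : Finset (Pt d)) : Poly d l →ₗ[ℝ] Module.Dual ℝ (Poly d l) :=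
  LinearMap.mk₂ ℝ (fun D φ => cellInt T (D.1 * φ.1))
    (fun _ _ _ => by simp [add_mul])
    (fun _ _ _ => by simp)
    (fun _ _ _ => by simp [mul_add])
    (fun _ _ _ => by simp)

lemma polyForm_apply (l : ℕ) (T : Finset (Pt d)) (D φ : Poly d l) :
    polyForm l T D φ = cellInt T (D.1 * φ.1) := rfl

lemma IsSimplex.polyForm_definite {T : Finset (Pt d)} (h : IsSimplex T) (l : ℕ)
    (D : Poly d l) (h0 : polyForm l T D D = 0) : D = 0 :=
  Subtype.ext (h.eq_zero_of_cellInt_mul_self h0)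

variable [NeZero d]

/-- The functional defining the weak gradient. -/
def gradFunctional (T : 𝒯.Cell) : WeakSpace 𝒯 k →ₗ[ℝ]
    Module.Dual ℝ (Matrix (Fin d) (Fin d) (Poly d (k - 1))) :=
  LinearMap.mk₂ ℝ (fun v φ =>
      -cellInt T.1 (∑ i, (v.1 T i).1 * ∑ j, MvPolynomial.pderiv j (φ i j).1)
      + ∑ e ∈ 𝒯.sides T, surfInt e.1 (∑ i, facePolyC k e.1 (v.2 e i) *
          ∑ j, outwardNormal T.1 e.1 j • polyC e.1 (φ i j).1))
    (fun _ _ _ => by simp [add_mul, Finset.sum_add_distrib]; ring)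
    (fun c _ _ => by simp [Finset.mul_sum, mul_add, mul_left_comm _ c])
    (fun _ _ _ => by simp [mul_add, Finset.sum_add_distrib]; ring)
    (fun _ _ _ => by simp [Finset.mul_sum, mul_add, smul_comm (outwardNormal _ _ _)])

lemma gradFunctional_apply (T : 𝒯.Cell) (v : WeakSpace 𝒯 k)
    (φ : Matrix (Fin d) (Fin d) (Poly d (k - 1))) : gradFunctional T v φ =
      -cellInt T.1 (∑ i, (v.1 T i).1 * ∑ j, MvPolynomial.pderiv j (φ i j).1)
      + ∑ e ∈ 𝒯.sides T, surfInt e.1 (∑ i, facePolyC k e.1 (v.2 e i) *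
          ∑ j, outwardNormal T.1 e.1 j • polyC e.1 (φ i j).1) := rfl

lemma isWeakGrad_iff {v : WeakSpace 𝒯 k} {T : 𝒯.Cell}
    {G : Matrix (Fin d) (Fin d) (Poly d (k - 1))} :
    IsWeakGrad v T G ↔ ∀ φ, matrixForm (k - 1) T.1 G φ = gradFunctional T v φ := by
  refine forall_congr' fun φ => ?_
  rw [matrixForm_apply, gradFunctional_apply]
  simp [-map_sum, cellInt_apply, surfInt_apply, mul_comm (outwardNormal _ _ _)]

/-- The weak gradient as a linear map. -/
def weakGradL (T : 𝒯.Cell) : WeakSpace 𝒯 k →ₗ[ℝ] Matrix (Fin d) (Fin d) (Poly d (k - 1)) :=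
  (rieszEquiv (matrixForm (k - 1) T.1) ((isSimplex T).matrixForm_definite (k - 1))).symm.toLinearMap
    ∘ₗ gradFunctional T

lemma isWeakGrad_iff_eq {v : WeakSpace 𝒯 k} {T : 𝒯.Cell}
    {G : Matrix (Fin d) (Fin d) (Poly d (k - 1))} : IsWeakGrad v T G ↔ G = weakGradL T v := by
  rw [isWeakGrad_iff, weakGradL, LinearMap.comp_apply, LinearEquiv.coe_coe, eq_rieszEquiv_symm]

/-- `Classical.epsilon` satisfies the defining property as soon as some matrix does, and uniqueness
then identifies it; the weak gradient thereby becomes linear in `v`. -/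
lemma weakGrad_eq (v : WeakSpace 𝒯 k) (T : 𝒯.Cell) : weakGrad v T = weakGradL T v :=
  isWeakGrad_iff_eq.1 (Classical.epsilon_spec ⟨weakGradL T v, isWeakGrad_iff_eq.2 rfl⟩)

/-! ### Weak divergence -/

/-- The functional defining the weak divergence. -/
def divFunctional (T : 𝒯.Cell) : WeakSpace 𝒯 k →ₗ[ℝ] Module.Dual ℝ (Poly d k) :=
  LinearMap.mk₂ ℝ (fun v φ =>
      -cellInt T.1 (∑ i, (v.1 T i).1 * MvPolynomial.pderiv i φ.1)
      + ∑ e ∈ 𝒯.sides T, surfInt e.1 ((∑ i, outwardNormal T.1 e.1 i • facePolyC k e.1 (v.2 e i)) *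
          polyC e.1 φ.1))
    (fun _ _ _ => by simp [add_mul, Finset.sum_add_distrib]; ring)
    (fun _ _ _ => by
      simp [Finset.mul_sum, Finset.sum_mul, mul_add, smul_comm (outwardNormal _ _ _)])
    (fun _ _ _ => by simp [mul_add, Finset.sum_add_distrib]; ring)
    (fun _ _ _ => by simp [Finset.mul_sum, mul_add])

lemma isWeakDiv_iff {v : WeakSpace 𝒯 k} {T : 𝒯.Cell} {D : Poly d k} :
    IsWeakDiv v T D ↔ ∀ φ, polyForm k T.1 D φ = divFunctional T v φ := by
  refine forall_congr' fun φ => ?_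
  rw [polyForm_apply]
  simp [-map_sum, divFunctional, cellInt_apply, surfInt_apply, mul_comm (outwardNormal _ _ _)]

/-- The weak divergence as a linear map. -/
def weakDivL (T : 𝒯.Cell) : WeakSpace 𝒯 k →ₗ[ℝ] Poly d k :=
  (rieszEquiv (polyForm k T.1) ((isSimplex T).polyForm_definite k)).symm.toLinearMap
    ∘ₗ divFunctional T

lemma isWeakDiv_iff_eq {v : WeakSpace 𝒯 k} {T : 𝒯.Cell} {D : Poly d k} :
    IsWeakDiv v T D ↔ D = weakDivL T v := by
  rw [isWeakDiv_iff, weakDivL, LinearMap.comp_apply, LinearEquiv.coe_coe, eq_rieszEquiv_symm]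

lemma weakDiv_eq (v : WeakSpace 𝒯 k) (T : 𝒯.Cell) : weakDiv v T = weakDivL T v :=
  isWeakDiv_iff_eq.1 (Classical.epsilon_spec ⟨weakDivL T v, isWeakDiv_iff_eq.2 rfl⟩)

/-! ### Moments of the reconstruction -/

/-- The component along `n` of the boundary part of `v`, on the side `e`. -/
def normalTrace (n : Pt d) (e : 𝒯.Face) : WeakSpace 𝒯 k →ₗ[ℝ] C(hull e.1, ℝ) :=
  (LinearMap.lsum ℝ (fun _ => FacePoly k e.1) ℝ (fun i => n i • facePolyC k e.1)) ∘ₗ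
    LinearMap.proj e ∘ₗ LinearMap.snd ℝ _ _

omit [NeZero d] in
@[simp] lemma normalTrace_apply (n : Pt d) (e : 𝒯.Face) (v : WeakSpace 𝒯 k) (x : hull e.1) :
    normalTrace n e v x = ∑ i, (v.2 e i).1 x * n i := by
  simp [normalTrace, LinearMap.lsum_apply, mul_comm]

open Classical in
/-- The degrees of freedom prescribed for the reconstruction on `T`. -/
def reconMoments (T : 𝒯.Cell) : WeakSpace 𝒯 k →ₗ[ℝ]
    Module.Dual ℝ (Fin d → Poly d (k - 1)) ×
      ((a : T.1) → Module.Dual ℝ (FacePoly k (T.1.erase (a : Pt d)))) :=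
  ((interiorMoment (k - 1) T.1 ∘ₗ (LinearMap.pi fun i =>
      (Poly d k).subtype ∘ₗ LinearMap.proj i)) ∘ₗ LinearMap.proj T ∘ₗ LinearMap.fst ℝ _ _).prod
    (LinearMap.pi fun a => sideMoment k (sideOf (NeZero.pos d) T a).1 ∘ₗ
      normalTrace (outwardNormal T.1 (sideOf (NeZero.pos d) T a).1) (sideOf (NeZero.pos d) T a))

/-- `r` has the moments prescribed by `v`. -/
def HasMoments (v : WeakSpace 𝒯 k) (T : 𝒯.Cell) (r : RT d k) : Prop :=
  (∀ w : Fin d → Poly d (k - 1),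
    ∫ x in hull T.1, ∑ i, pval (r.1 i) x * pval (w i).1 x =
      ∫ x in hull T.1, ∑ i, pval (v.1 T i).1 x * pval (w i).1 x) ∧
  ∀ e ∈ 𝒯.sides T, ∀ φ : FacePoly k e.1,
    ∫ x : hull e.1, (∑ i, pval (r.1 i) x * outwardNormal T.1 e.1 i) * φ.1 x ∂(surf e.1) =
      ∫ x : hull e.1, (∑ i, (v.2 e i).1 x * outwardNormal T.1 e.1 i) * φ.1 x ∂(surf e.1)

lemma hasMoments_iff {v : WeakSpace 𝒯 k} {T : 𝒯.Cell} {r : RT d k} :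
    HasMoments v T r ↔ (isSimplex T).moments (NeZero.pos d) k r = reconMoments T v := by
  rw [Prod.ext_iff, HasMoments]
  refine and_congr ?_ ?_
  · refine Iff.trans (forall_congr' fun w => ?_) LinearMap.ext_iff.symm
    simp [-map_sum, IsSimplex.moments, reconMoments, interiorMoment, cellInt_apply]
  · refine Iff.trans ?_ funext_iff.symm
    have key : ∀ a : T.1, ((isSimplex T).moments (NeZero.pos d) k r).2 a = (reconMoments T v).2 a ↔
        ∀ φ : FacePoly k (sideOf (NeZero.pos d) T a).1,
          ∫ x : hull (sideOf (NeZero.pos d) T a).1,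
            (∑ i, pval (r.1 i) x * outwardNormal T.1 (sideOf (NeZero.pos d) T a).1 i) * φ.1 x
              ∂(surf (sideOf (NeZero.pos d) T a).1) =
          ∫ x : hull (sideOf (NeZero.pos d) T a).1,
            (∑ i, (v.2 (sideOf (NeZero.pos d) T a) i).1 x *
              outwardNormal T.1 (sideOf (NeZero.pos d) T a).1 i) * φ.1 x
              ∂(surf (sideOf (NeZero.pos d) T a).1) := by
      intro a
      refine LinearMap.ext_iff.trans (forall_congr' fun φ => ?_)
      have e1 : ((isSimplex T).moments (NeZero.pos d) k r).2 a φ =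
          ∫ x : hull (sideOf (NeZero.pos d) T a).1,
            dotTrace (outwardNormal T.1 (sideOf (NeZero.pos d) T a).1) _ r.1 x * φ.1 x
              ∂(surf (sideOf (NeZero.pos d) T a).1) := rfl
      have e2 : (reconMoments T v).2 a φ =
          ∫ x : hull (sideOf (NeZero.pos d) T a).1,
            normalTrace (outwardNormal T.1 (sideOf (NeZero.pos d) T a).1) _ v x * φ.1 x
              ∂(surf (sideOf (NeZero.pos d) T a).1) := rfl
      rw [e1, e2]
      simp
    refine ⟨fun h a => (key a).2 (h _ (sideOf_mem_sides _ T a)), fun h e he => ?_⟩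
    obtain ⟨a, rfl⟩ := exists_sideOf (NeZero.pos d) he
    exact (key a).1 (h a)

/-- The reconstruction as a linear map. -/
def reconL (hk : 1 ≤ k) : WeakSpace 𝒯 k →ₗ[ℝ] BrokenRT 𝒯 k :=
  LinearMap.pi fun T =>
    ((isSimplex T).momentEquiv (NeZero.pos d) hk).symm.toLinearMap ∘ₗ reconMoments T

lemma hasMoments_iff_eq (hk : 1 ≤ k) {v : WeakSpace 𝒯 k} {T : 𝒯.Cell} {r : RT d k} :
    HasMoments v T r ↔ r = reconL hk v T := by
  rw [hasMoments_iff, ← (isSimplex T).momentEquiv_apply (NeZero.pos d) hk,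
    ← LinearEquiv.eq_symm_apply]
  rfl

end WG

/-! ### The reconstruction is in `H(div)` -/

namespace WG

variable {d : ℕ} {Ω : Set (Pt d)} {𝒯 : SimplicialPartition Ω} {k : ℕ}

open SimplicialPartition

/-- The divergence theorem on a cell. -/
theorem integral_div [NeZero d] (T : 𝒯.Cell) (F : Fin d → Pt d → ℝ) (hF : ∀ i, ContDiff ℝ 1 (F i)) :
    ∫ x in hull T.1, ∑ i, fderiv ℝ (F i) x (EuclideanSpace.single i 1) =
      ∑ e ∈ 𝒯.sides T, ∫ x : hull e.1, ∑ i, F i x * outwardNormal T.1 e.1 i ∂(surf e.1) := by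
  classical
  have hd := NeZero.pos d
  rw [integral_finsetSum]
  · have h1 : ∀ e : 𝒯.Face, ∫ x : hull e.1, ∑ i, F i x * outwardNormal T.1 e.1 i ∂(surf e.1)
        = ∑ i, ∫ x : hull e.1, F i x * ⟪outwardNormal T.1 e.1, EuclideanSpace.single i 1⟫
          ∂(surf e.1) := by
      intro e
      rw [← integral_finsetSum]
      · simp only [EuclideanSpace.inner_single_right, conj_trivial, one_mul]
      · intro i _
        exact integrable_surf (((hF i).continuous.comp continuous_subtype_val).mul
          continuous_const)
    rw [Finset.sum_congr rfl fun e _ => h1 e, Finset.sum_comm]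
    refine Finset.sum_congr rfl fun i _ => ?_
    rw [(isSimplex T).integral_fderiv hd (F i) (hF i), sum_sides hd T]
    rfl
  · intro i _
    have := (hF i).continuous_fderiv one_ne_zero
    exact ContinuousOn.integrableOn_compact (isCompact_hull _) (by fun_prop)

/-- Broken fields are defined by the open cells, whereas the divergence theorem is stated on the
closed ones; the frontier of a convex set is null. -/
lemma interior_ae_eq (T : Finset (Pt d)) : interior (hull T) =ᵐ[volume] hull T :=
  interior_ae_eq_of_null_frontier (Convex.addHaar_frontier volume (convex_convexHull ℝ _))

lemma memLp_indicator {E : Type*} [NormedAddCommGroup E] {F : Pt d → E}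
    [SecondCountableTopologyEither (Pt d) E] (hF : Continuous F)
    (T : Finset (Pt d)) : MemLp ((interior (hull T)).indicator F) 2 (volume : Measure (Pt d)) := by
  rw [memLp_indicator_iff_restrict isOpen_interior.measurableSet]
  have hfin : IsFiniteMeasure (volume.restrict (interior (hull T))) :=
    ⟨by rw [Measure.restrict_apply_univ]
        exact (measure_mono interior_subset).trans_lt (isCompact_hull T).measure_lt_top⟩
  obtain ⟨C, hC⟩ := (isCompact_hull T).exists_bound_of_continuousOn hF.continuousOn
  refine MemLp.of_bound hF.aestronglyMeasurable C ?_
  exact (ae_restrict_iff' isOpen_interior.measurableSet).2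
    (Filter.Eventually.of_forall fun x hx => hC x (interior_subset hx))

/-- A polynomial vector field. -/
def vfield (r : Fin d → MvPolynomial (Fin d) ℝ) (x : Pt d) : Pt d :=
  WithLp.toLp 2 fun i => pval (r i) x

lemma continuous_vfield (r : Fin d → MvPolynomial (Fin d) ℝ) : Continuous (vfield r) :=
  (PiLp.continuous_toLp 2 _).comp (continuous_pi fun i => continuous_pval (r i))

lemma toFun_eq (r : BrokenRT 𝒯 k) (x : Pt d) :
    r.toFun x = ∑ T : 𝒯.Cell, (interior (hull T.1)).indicator (vfield (r T).1) x := by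
  ext i
  rw [BrokenRT.toFun, WithLp.ofLp_sum, Finset.sum_apply]
  refine Finset.sum_congr rfl fun T _ => ?_
  by_cases hx : x ∈ interior (hull T.1) <;> simp [hx, vfield]

lemma memLp_toFun (r : BrokenRT 𝒯 k) : MemLp r.toFun 2 (volume : Measure (Pt d)) := by
  have : r.toFun = fun x => ∑ T : 𝒯.Cell, (interior (hull T.1)).indicator (vfield (r T).1) x :=
    funext (toFun_eq r)
  rw [this]
  exact memLp_finsetSum _ fun T _ => memLp_indicator (continuous_vfield _) T.1

lemma toFun_add (r s : BrokenRT 𝒯 k) (x : Pt d) : (r + s).toFun x = r.toFun x + s.toFun x := by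
  simp only [toFun_eq, ← Finset.sum_add_distrib]
  refine Finset.sum_congr rfl fun T _ => ?_
  by_cases hx : x ∈ interior (hull T.1)
  · simp only [Set.indicator_of_mem hx]
    ext i; simp [vfield]
  · simp only [Set.indicator_of_notMem hx, add_zero]

lemma toFun_smul (c : ℝ) (r : BrokenRT 𝒯 k) (x : Pt d) : (c • r).toFun x = c • r.toFun x := by
  simp only [toFun_eq, Finset.smul_sum]
  refine Finset.sum_congr rfl fun T _ => ?_
  by_cases hx : x ∈ interior (hull T.1)
  · simp only [Set.indicator_of_mem hx]
    ext i; simp [vfield]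
  · simp only [Set.indicator_of_notMem hx, smul_zero]

/-- The divergence of a polynomial field. -/
def pdiv (r : Fin d → MvPolynomial (Fin d) ℝ) : MvPolynomial (Fin d) ℝ :=
  ∑ i, MvPolynomial.pderiv i (r i)

lemma sum_fderiv_mul {φ : Pt d → ℝ} (hφ : ContDiff ℝ 1 φ) (r : Fin d → MvPolynomial (Fin d) ℝ)
    (x : Pt d) :
    ∑ i, fderiv ℝ (fun y => φ y * pval (r i) y) x (EuclideanSpace.single i 1) =
      fderiv ℝ φ x (vfield r x) + pval (pdiv r) x * φ x := by
  have h1 : ∀ i, fderiv ℝ (fun y => φ y * pval (r i) y) x (EuclideanSpace.single i 1) =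
      fderiv ℝ φ x (EuclideanSpace.single i 1) * pval (r i) x
        + pval (MvPolynomial.pderiv i (r i)) x * φ x := by
    intro i
    rw [fderiv_fun_mul ((hφ.differentiable one_ne_zero) x)
      ((contDiff_pval (r i) (n := 1)).differentiable one_ne_zero x)]
    simp only [add_apply, smul_apply, smul_eq_mul, fderiv_pval]
    rw [Finset.sum_eq_single i]
    · simp; ring
    · intro j _ hj; simp [hj]
    · simp
  have h2 : vfield r x = ∑ i, pval (r i) x • EuclideanSpace.single i (1 : ℝ) := by
    ext j
    simp [vfield, Pi.single_apply]
  rw [Finset.sum_congr rfl fun i _ => h1 i, Finset.sum_add_distrib, h2, map_sum, pdiv, pval_sum,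
    Finset.sum_mul]
  congr 1
  exact Finset.sum_congr rfl fun i _ => by simp [mul_comm]

/-- Both normal traces lie in `P_k(e)`, and their moments are those of the single-valued `v_b`
against opposite normals. So the sum is orthogonal to `P_k(e)` and belongs to it. -/
lemma dotTrace_add_eq_zero [NeZero d] {v : WeakSpace 𝒯 k} {r : BrokenRT 𝒯 k}
    (hr : ∀ T, HasMoments v T (r T)) {T₁ T₂ : 𝒯.Cell} {e : 𝒯.Face} (h1 : e ∈ 𝒯.sides T₁)
    (h2 : e ∈ 𝒯.sides T₂) (hn : outwardNormal T₂.1 e.1 = -outwardNormal T₁.1 e.1) :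
    dotTrace (outwardNormal T₁.1 e.1) e.1 (r T₁).1 + dotTrace (outwardNormal T₂.1 e.1) e.1 (r T₂).1
      = 0 := by
  have hd := NeZero.pos d
  have hmem : ∀ T, e ∈ 𝒯.sides T → ∃ φ : FacePoly k e.1,
      facePolyC k _ φ = dotTrace (outwardNormal T.1 e.1) e.1 (r T).1 := by
    intro T hT
    obtain ⟨a, rfl⟩ := exists_sideOf hd hT
    exact (isSimplex T).dotTrace_mem_facePoly hd (r T).2 a
  obtain ⟨φ₁, hφ₁⟩ := hmem T₁ h1
  obtain ⟨φ₂, hφ₂⟩ := hmem T₂ h2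
  refine eq_zero_of_surfInt_mul_self ?_
  have key : ∀ T, e ∈ 𝒯.sides T → ∀ φ : FacePoly k e.1,
      surfInt e.1 (dotTrace (outwardNormal T.1 e.1) e.1 (r T).1 * facePolyC k _ φ) =
        surfInt e.1 (normalTrace (outwardNormal T.1 e.1) e v * facePolyC k _ φ) := by
    intro T hT φ
    simpa [surfInt_apply] using (hr T).2 e hT φ
  have hneg : normalTrace (outwardNormal T₂.1 e.1) e v =
      -normalTrace (outwardNormal T₁.1 e.1) e v := by
    ext x; simp [hn]
  have hs : dotTrace (outwardNormal T₁.1 e.1) e.1 (r T₁).1 +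
      dotTrace (outwardNormal T₂.1 e.1) e.1 (r T₂).1 = facePolyC k e.1 (φ₁ + φ₂) := by
    rw [map_add, hφ₁, hφ₂]
  nth_rewrite 2 [hs]
  rw [add_mul, map_add, key T₁ h1, key T₂ h2, hneg, ← map_add]
  simp

/-- A broken Raviart--Thomas field with the moments of a weak function is in `H(div)`. -/
theorem memHDiv_of_hasMoments [NeZero d] (hΩ : IsOpen Ω) {v : WeakSpace 𝒯 k} {r : BrokenRT 𝒯 k}
    (hr : ∀ T, HasMoments v T (r T)) : MemHDiv Ω r.toFun := by
  -- The distributional divergence is the cellwise one.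
  refine ⟨(memLp_toFun r).restrict _,
    fun x => ∑ T : 𝒯.Cell, (interior (hull T.1)).indicator (pval (pdiv (r T).1)) x, ?_, ?_⟩
  · exact (memLp_finsetSum _ fun T _ => memLp_indicator (continuous_pval _) T.1).restrict _
  intro φ hφ hφc hφΩ
  have hφ1 : ContDiff ℝ 1 φ := hφ.of_le (by simp)
  have hdφ : Continuous (fderiv ℝ φ) := hφ1.continuous_fderiv one_ne_zero
  have hz : ∀ x ∉ Ω, φ x = 0 ∧ fderiv ℝ φ x = 0 := fun x hx =>
    ⟨image_eq_zero_of_notMem_tsupport fun h => hx (hφΩ h),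
      image_eq_zero_of_notMem_tsupport fun h => hx (hφΩ (tsupport_fderiv_subset ℝ h))⟩
  rw [setIntegral_eq_integral_of_forall_compl_eq_zero fun x hx => by simp [(hz x hx).2],
    setIntegral_eq_integral_of_forall_compl_eq_zero fun x hx => by simp [(hz x hx).1]]
  have c1 : ∀ T : 𝒯.Cell, Continuous fun x => fderiv ℝ φ x (vfield (r T).1 x) := fun T =>
    hdφ.clm_apply (continuous_vfield _)
  have c2 : ∀ T : 𝒯.Cell, Continuous fun x => pval (pdiv (r T).1) x * φ x := fun T =>
    (continuous_pval _).mul hφ.continuous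
  have hint : ∀ (F : Pt d → ℝ) (T : 𝒯.Cell), Continuous F →
      Integrable ((interior (hull T.1)).indicator F) := fun F T hF =>
    (integrable_indicator_iff isOpen_interior.measurableSet).2
      ((hF.continuousOn.integrableOn_compact (isCompact_hull T.1)).mono_set interior_subset)
  have e1 : ∀ x, fderiv ℝ φ x (r.toFun x) = ∑ T : 𝒯.Cell,
      (interior (hull T.1)).indicator (fun x => fderiv ℝ φ x (vfield (r T).1 x)) x := by
    intro x
    rw [toFun_eq, map_sum]
    refine Finset.sum_congr rfl fun T _ => ?_
    by_cases hx : x ∈ interior (hull T.1) <;> simp [hx]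
  have e2 : ∀ x, (∑ T : 𝒯.Cell, (interior (hull T.1)).indicator (pval (pdiv (r T).1)) x) * φ x =
      ∑ T : 𝒯.Cell,
        (interior (hull T.1)).indicator (fun x => pval (pdiv (r T).1) x * φ x) x := by
    intro x
    rw [Finset.sum_mul]
    refine Finset.sum_congr rfl fun T _ => ?_
    by_cases hx : x ∈ interior (hull T.1) <;> simp [hx]
  simp only [e1, e2]
  rw [integral_finsetSum _ fun T _ => hint _ T (c1 T),
    integral_finsetSum _ fun T _ => hint _ T (c2 T), ← add_eq_zero_iff_eq_neg,
    ← Finset.sum_add_distrib]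
  -- Integration by parts on each cell leaves only the flux of `φ r` through its sides. On boundary
  -- faces `φ` vanishes, and at interior faces the normal traces cancel.
  have hT : ∀ T : 𝒯.Cell,
      (∫ x, (interior (hull T.1)).indicator (fun x => fderiv ℝ φ x (vfield (r T).1 x)) x) +
      ∫ x, (interior (hull T.1)).indicator (fun x => pval (pdiv (r T).1) x * φ x) x =
      ∑ e ∈ 𝒯.sides T, ∫ x : hull e.1,
        φ x * dotTrace (outwardNormal T.1 e.1) e.1 (r T).1 x ∂(surf e.1) := by
    intro T
    rw [integral_indicator isOpen_interior.measurableSet,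
      integral_indicator isOpen_interior.measurableSet, setIntegral_congr_set (interior_ae_eq T.1),
      setIntegral_congr_set (interior_ae_eq T.1), ← integral_add
        ((c1 T).continuousOn.integrableOn_compact (isCompact_hull T.1))
        ((c2 T).continuousOn.integrableOn_compact (isCompact_hull T.1))]
    simp only [← sum_fderiv_mul hφ1]
    rw [integral_div T _ fun i => hφ1.mul (contDiff_pval _)]
    simp [Finset.mul_sum, mul_assoc]
  rw [Finset.sum_congr rfl fun T _ => hT T]
  refine sum_sides_eq_zero (NeZero.pos d) hΩ (fun T e => ∫ x : hull e.1,
        φ x * dotTrace (outwardNormal T.1 e.1) e.1 (r T).1 x ∂(surf e.1)) ?_ ?_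
  · intro T e _ hb
    have : ∀ x : hull e.1, φ x = 0 := fun x => (hz x fun hx =>
      (disjoint_interior_frontier (s := Ω)).le_bot ⟨hΩ.interior_eq.symm ▸ hx, hb x.2⟩).1
    simp [this]
  · intro T₁ T₂ e h1 h2 hn
    have hc : Continuous fun x : hull e.1 => φ x := hφ.continuous.comp continuous_subtype_val
    have hi : ∀ D : C(hull e.1, ℝ), Integrable (fun x : hull e.1 => φ x * D x) (surf e.1) :=
      fun D => integrable_surf (hc.mul D.continuous)
    rw [← integral_add (hi _) (hi _)]
    have h3 := dotTrace_add_eq_zero hr h1 h2 hn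
    have h4 : ∀ x, dotTrace (outwardNormal T₁.1 e.1) e.1 (r T₁).1 x +
        dotTrace (outwardNormal T₂.1 e.1) e.1 (r T₂).1 x = 0 := fun x => DFunLike.congr_fun h3 x
    simp only [← mul_add, h4, mul_zero, integral_zero]

/-- The moments alone determine the field cell by cell, and `H(div)` membership comes as a
consequence of them. -/
lemma isReconstruction_iff_eq [NeZero d] (hΩ : IsOpen Ω) (hk : 1 ≤ k) {v : WeakSpace 𝒯 k}
    {r : BrokenRT 𝒯 k} : IsReconstruction v r ↔ r = reconL hk v := by
  constructor
  · intro h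
    funext T
    exact (hasMoments_iff_eq hk).1 ⟨h.interior_moments T, h.side_moments T⟩
  · intro h
    have hr : ∀ T, HasMoments v T (r T) := fun T => (hasMoments_iff_eq hk).2 (congr_fun h T)
    exact ⟨memHDiv_of_hasMoments hΩ hr, fun T => (hr T).1, fun T => (hr T).2⟩

lemma reconstruct_eq [NeZero d] (hΩ : IsOpen Ω) (hk : 1 ≤ k) (v : WeakSpace 𝒯 k) :
    reconstruct v = reconL hk v :=
  (isReconstruction_iff_eq hΩ hk).1
    (Classical.epsilon_spec ⟨reconL hk v, (isReconstruction_iff_eq hΩ hk).2 rfl⟩)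

end WG

/-! ### Cellwise constant functions -/

namespace WG

variable {d : ℕ} {Ω : Set (Pt d)} {𝒯 : SimplicialPartition Ω} {k : ℕ}

open SimplicialPartition

/-- A function with a nonnegative partial derivative that is supported near a given point. -/
lemma exists_partial_bump (j : Fin d) {U : Set (Pt d)} (hU : IsOpen U) {x₀ : Pt d} (hx : x₀ ∈ U) :
    ∃ F : Pt d → ℝ, ContDiff ℝ 1 F ∧
      (∀ x, 0 ≤ fderiv ℝ F x (EuclideanSpace.single j 1)) ∧
      (∀ x ∉ U, fderiv ℝ F x (EuclideanSpace.single j 1) = 0) ∧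
      0 < fderiv ℝ F x₀ (EuclideanSpace.single j 1) := by
  have hU' : IsOpen ((WithLp.toLp 2 : (Fin d → ℝ) → Pt d) ⁻¹' U) :=
    hU.preimage (PiLp.continuous_toLp 2 _)
  obtain ⟨ε, hε, hb⟩ := Metric.isOpen_iff.1 hU' (WithLp.ofLp x₀) (by simpa using hx)
  let b : (i : Fin d) → ContDiffBump (x₀ i) := fun i => ⟨ε / 2, ε, by positivity, by linarith⟩
  -- Replacing the bump in the variable `j` by its antiderivative makes the `j`-th partial
  -- derivative of `A (x j) * P x` a product of bumps. The function itself is not compactly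
  -- supported, only this derivative is controlled.
  let A : ℝ → ℝ := fun t => ∫ s in (0 : ℝ)..t, b j s
  have hA : ∀ t, HasDerivAt A (b j t) t := fun t =>
    intervalIntegral.integral_hasDerivAt_right ((b j).continuous.intervalIntegrable _ _)
      ((b j).continuous.stronglyMeasurableAtFilter _ _) (b j).continuous.continuousAt
  have hAc : ContDiff ℝ 1 A := by
    rw [contDiff_one_iff_deriv]
    refine ⟨fun t => (hA t).differentiableAt, ?_⟩
    rw [show deriv A = b j from funext fun t => (hA t).deriv]
    exact (b j).continuous
  let P : Pt d → ℝ := fun x => ∏ i ∈ Finset.univ.erase j, b i (x i)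
  have hP : ContDiff ℝ 1 P := contDiff_prod fun i _ =>
    (b i).contDiff.comp (EuclideanSpace.proj i : Pt d →L[ℝ] ℝ).contDiff
  have hF : ContDiff ℝ 1 fun x : Pt d => A (x j) * P x :=
    (hAc.comp (EuclideanSpace.proj j : Pt d →L[ℝ] ℝ).contDiff).mul hP
  have hder : ∀ x, fderiv ℝ (fun x : Pt d => A (x j) * P x) x (EuclideanSpace.single j 1)
      = ∏ i, b i (x i) := by
    intro x
    have h1 : HasDerivAt (fun t : ℝ => x + t • EuclideanSpace.single j (1 : ℝ))
        (EuclideanSpace.single j (1 : ℝ)) 0 := by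
      simpa using ((hasDerivAt_id (0 : ℝ)).smul_const (EuclideanSpace.single j (1 : ℝ))).const_add x
    have h2 : HasFDerivAt (fun x : Pt d => A (x j) * P x)
        (fderiv ℝ (fun x : Pt d => A (x j) * P x) x) (x + (0 : ℝ) • EuclideanSpace.single j (1 : ℝ)) := by
      rw [zero_smul, add_zero]
      exact ((hF.differentiable one_ne_zero) x).hasFDerivAt
    have h3 := h2.comp_hasDerivAt 0 h1
    have h4 : ((fun x : Pt d => A (x j) * P x) ∘ fun t : ℝ => x + t • EuclideanSpace.single j (1 : ℝ))
        = fun t => A (x j + t) * P x := by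
      funext t
      have hp : P (x + t • EuclideanSpace.single j (1 : ℝ)) = P x := by
        refine Finset.prod_congr rfl fun i hi => ?_
        have : i ≠ j := Finset.ne_of_mem_erase hi
        simp [this]
      simp [hp]
    rw [h4] at h3
    have h5 : HasDerivAt (fun t => A (x j + t) * P x) (b j (x j) * P x) 0 := by
      have := (hA (x j + 0)).comp_const_add (x j) 0
      rw [add_zero] at this
      exact this.mul_const _
    rw [h3.unique h5]
    exact Finset.mul_prod_erase Finset.univ (fun i => b i (x i)) (Finset.mem_univ j)
  refine ⟨_, hF, fun x => ?_, fun x hxU => ?_, ?_⟩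
  · rw [hder]; exact Finset.prod_nonneg fun i _ => (b i).nonneg
  · rw [hder]
    by_contra hne
    have hne := Finset.prod_ne_zero_iff.1 hne
    refine hxU ?_
    have : WithLp.ofLp x ∈ Metric.ball (WithLp.ofLp x₀) ε := by
      rw [ball_pi _ hε]
      intro i _
      have : x i ∈ Function.support (b i) := hne i (Finset.mem_univ i)
      rwa [(b i).support_eq] at this
    simpa using hb this
  · rw [hder]
    exact Finset.prod_pos fun i _ => (b i).pos_of_mem_ball (Metric.mem_ball_self hε)

variable [NeZero d]

/-- A piecewise constant function that does not jump across interior faces and vanishes at the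
boundary is zero. -/
theorem cellConst_eq_zero (hΩ : IsOpen Ω) (c : 𝒯.Cell → ℝ)
    (hb : ∀ T, ∀ e ∈ 𝒯.sides T, OnBoundary Ω e.1 → c T = 0)
    (hi : ∀ T₁ T₂ e, e ∈ 𝒯.sides T₁ → e ∈ 𝒯.sides T₂ → c T₁ = c T₂) (T₀ : 𝒯.Cell) : c T₀ = 0 := by
  have hd := NeZero.pos d
  set j : Fin d := ⟨0, hd⟩
  -- The sum of `c T * ∫_T ∂_j F` over all cells reduces to side terms, which cancel because `c`
  -- does not jump and vanishes at the boundary. As `∂_j F` is concentrated in `T₀` with positive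
  -- integral, `c T₀ = 0`; no propagation from cell to cell is involved.
  obtain ⟨F, hF, h0, hout, hpos⟩ := exists_partial_bump j isOpen_interior
    (isSimplex T₀).centroid_mem_interior
  set z : Pt d := EuclideanSpace.single j 1
  have hcell : ∀ T : 𝒯.Cell, c T * ∫ x in hull T.1, fderiv ℝ F x z =
      ∑ e ∈ 𝒯.sides T, c T * ∫ x : hull e.1, F x * ⟪outwardNormal T.1 e.1, z⟫ ∂(surf e.1) := by
    intro T
    rw [(isSimplex T).integral_fderiv hd F hF z, sum_sides hd T, Finset.mul_sum]
    rfl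
  have hsum : ∑ T : 𝒯.Cell, c T * ∫ x in hull T.1, fderiv ℝ F x z = 0 := by
    rw [Finset.sum_congr rfl fun T _ => hcell T]
    refine sum_sides_eq_zero hd hΩ
      (fun T e => c T * ∫ x : hull e.1, F x * ⟪outwardNormal T.1 e.1, z⟫ ∂(surf e.1)) ?_ ?_
    · intro T e he hbe
      rw [hb T e he hbe, zero_mul]
    · intro T₁ T₂ e h1 h2 hn
      simp only [hn, inner_neg_left, mul_neg, integral_neg, hi T₁ T₂ e h1 h2]
      ring
  have hcont : Continuous fun x => fderiv ℝ F x z :=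
    (hF.continuous_fderiv one_ne_zero).clm_apply continuous_const
  rw [Finset.sum_eq_single T₀] at hsum
  · refine (mul_eq_zero.1 hsum).resolve_right fun hz => hpos.ne' ?_
    exact (isSimplex T₀).eqOn_zero_of_setIntegral_eq_zero hcont (fun x _ => h0 x) hz _
      (interior_subset (isSimplex T₀).centroid_mem_interior)
  · intro T _ hne
    rw [setIntegral_eq_zero_of_forall_eq_zero, mul_zero]
    exact fun x hx => hout x fun hx0 => hne (eq_of_mem_interior hx0 hx).symm
  · intro h; exact absurd (Finset.mem_univ _) h

/-! ### Kernel of the weak gradient on functions without jumps. -/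

omit [NeZero d] in
lemma pderiv_mem_Poly {p : MvPolynomial (Fin d) ℝ} (hp : p ∈ Poly d k) (i : Fin d) :
    MvPolynomial.pderiv i p ∈ Poly d (k - 1) := by
  rw [mem_Poly] at *
  rw [MvPolynomial.totalDegree]
  refine Finset.sup_le fun m hm => ?_
  rw [MvPolynomial.mem_support_iff, MvPolynomial.coeff_pderiv] at hm
  have h1 : m + Finsupp.single i 1 ∈ p.support :=
    MvPolynomial.mem_support_iff.2 fun h0 => hm (by rw [h0]; simp)
  have h2 := (MvPolynomial.le_totalDegree h1).trans hp
  rw [Finsupp.sum_add_index' (fun _ => rfl) (fun _ _ _ => rfl), Finsupp.sum_single_index rfl] at h2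
  omega

omit [NeZero d] in
lemma eq_C_of_pderiv_eq_zero {p : MvPolynomial (Fin d) ℝ}
    (hp : ∀ i, MvPolynomial.pderiv i p = 0) : p = MvPolynomial.C (pval p 0) := by
  have hconst : ∀ x, pval p x = pval p 0 := fun x =>
    is_const_of_fderiv_eq_zero ((contDiff_pval p (n := 1)).differentiable one_ne_zero) (fun y => by
      ext z; rw [fderiv_pval]; simp [hp]) x 0
  rw [← sub_eq_zero]
  exact eq_zero_of_pval_eq_zero isOpen_univ Set.univ_nonempty fun x _ => by
    rw [pval_sub, pval_C, hconst, sub_self]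

lemma cellInt_pdiv (T : 𝒯.Cell) (P : Fin d → MvPolynomial (Fin d) ℝ) :
    cellInt T.1 (pdiv P) = ∑ e ∈ 𝒯.sides T, surfInt e.1 (dotTrace (outwardNormal T.1 e.1) e.1 P) := by
  have := integral_div T (fun i => pval (P i)) fun i => contDiff_pval _
  rw [cellInt_apply]
  simp only [surfInt_apply, dotTrace_apply, ← this, pdiv, pval_sum]
  refine integral_congr_ae (Filter.Eventually.of_forall fun x => Finset.sum_congr rfl fun i _ => ?_)
  rw [fderiv_pval, Finset.sum_eq_single i]
  · simp
  · intro j _ hj; simp [hj]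
  · simp

/-- The weak gradient of a weak function without jumps is the gradient of its interior part. -/
lemma pderiv_eq_zero_of_weakGrad {v : WeakSpace 𝒯 k} {T : 𝒯.Cell} (hG : weakGradL T v = 0)
    (hj : ∀ e ∈ 𝒯.sides T, ∀ i, polyC e.1 (v.1 T i).1 = facePolyC k e.1 (v.2 e i)) (i j : Fin d) :
    MvPolynomial.pderiv j (v.1 T i).1 = 0 := by
  -- Test with the gradient of `v₀`, which has degree at most `k - 1`. Without jumps `v_b` may be
  -- replaced by `v₀` on the sides, and the divergence theorem with the product rule turns the
  -- defining identity into `∫ |∇v₀|² = 0`.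
  let φ : Matrix (Fin d) (Fin d) (Poly d (k - 1)) := fun i j =>
    ⟨MvPolynomial.pderiv j (v.1 T i).1, pderiv_mem_Poly (v.1 T i).2 j⟩
  let P : Fin d → MvPolynomial (Fin d) ℝ := fun j => ∑ i, (v.1 T i).1 * (φ i j).1
  have h1 := isWeakGrad_iff.1 (isWeakGrad_iff_eq.2 hG.symm) φ
  rw [map_zero, LinearMap.zero_apply, gradFunctional_apply] at h1
  have h2 : ∑ e ∈ 𝒯.sides T, surfInt e.1 (∑ i, facePolyC k e.1 (v.2 e i) *
      ∑ j, outwardNormal T.1 e.1 j • polyC e.1 (φ i j).1) = cellInt T.1 (pdiv P) := by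
    rw [cellInt_pdiv]
    refine Finset.sum_congr rfl fun e he => ?_
    congr 1
    ext x
    rw [dotTrace_apply]
    simp only [← hj e he, ContinuousMap.coe_sum, Finset.sum_apply, ContinuousMap.mul_apply,
      ContinuousMap.coe_smul, Pi.smul_apply, polyC_apply, smul_eq_mul, P, pval_sum, pval_mul,
      Finset.mul_sum, Finset.sum_mul]
    rw [Finset.sum_comm]
    exact Finset.sum_congr rfl fun j _ => Finset.sum_congr rfl fun i _ => by ring
  have h3 : pdiv P = ∑ i, ∑ j, (φ i j).1 * (φ i j).1 +
      ∑ i, (v.1 T i).1 * ∑ j, MvPolynomial.pderiv j (φ i j).1 := by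
    simp only [pdiv, P, map_sum, Derivation.leibniz, smul_eq_mul, Finset.sum_add_distrib,
      Finset.mul_sum]
    rw [add_comm, Finset.sum_comm, Finset.sum_comm (f := fun j i => (v.1 T i).1 * _)]
  rw [h2, h3, map_add] at h1
  have h4 : φ = 0 := (isSimplex T).matrixForm_definite (k - 1) φ (by
    rw [matrixForm_apply]; linarith)
  exact congr_arg Subtype.val (congr_fun (congr_fun h4 i) j)

omit [NeZero d] in
lemma diamT_pos (hd : 0 < d) (T : 𝒯.Cell) : 0 < diamT T.1 := by
  have h1 : 1 < T.1.card := by rw [T.2.2]; omega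
  obtain ⟨a, ha, b, hb, hab⟩ := Finset.one_lt_card.1 h1
  exact Metric.diam_pos ⟨a, subset_convexHull ℝ _ ha, b, subset_convexHull ℝ _ hb, hab⟩
    (isCompact_hull T.1).isBounded

/-! ### The bilinear form -/

omit [NeZero d] in
/-- The `L²(e)` inner product of continuous vector fields on a side. -/
def sideForm (e : Finset (Pt d)) [IsFiniteMeasure (surf e)] :
    (Fin d → C(hull e, ℝ)) →ₗ[ℝ] Module.Dual ℝ (Fin d → C(hull e, ℝ)) :=
  LinearMap.mk₂ ℝ (fun f g => surfInt e (∑ i, f i * g i))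
    (fun _ _ _ => by simp [add_mul, Finset.sum_add_distrib])
    (fun _ _ _ => by simp [Finset.mul_sum])
    (fun _ _ _ => by simp [mul_add, Finset.sum_add_distrib])
    (fun _ _ _ => by simp [Finset.mul_sum])

omit [NeZero d] in
lemma sideForm_apply (e : Finset (Pt d)) [IsFiniteMeasure (surf e)] (f g : Fin d → C(hull e, ℝ)) :
    sideForm e f g = surfInt e (∑ i, f i * g i) := rfl

omit [NeZero d] in
lemma sideForm_nonneg (e : Finset (Pt d)) [IsFiniteMeasure (surf e)] (f : Fin d → C(hull e, ℝ)) :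
    0 ≤ sideForm e f f := by
  rw [sideForm_apply, map_sum]
  exact Finset.sum_nonneg fun i _ => surfInt_mul_self_nonneg _

omit [NeZero d] in
lemma sideForm_definite {e : Finset (Pt d)} [IsFiniteMeasure (surf e)] [(surf e).IsOpenPosMeasure]
    {f : Fin d → C(hull e, ℝ)} (h0 : sideForm e f f = 0) (i : Fin d) : f i = 0 := by
  rw [sideForm_apply, map_sum] at h0
  exact eq_zero_of_surfInt_mul_self ((Finset.sum_eq_zero_iff_of_nonneg fun i _ =>
    surfInt_mul_self_nonneg _).1 h0 i (Finset.mem_univ i))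

/-- The jump `v₀ - v_b` on a side of a cell. -/
def jump (T : 𝒯.Cell) (e : 𝒯.Face) : WeakSpace 𝒯 k →ₗ[ℝ] (Fin d → C(hull e.1, ℝ)) where
  toFun v i := polyC e.1 (v.1 T i).1 - facePolyC k e.1 (v.2 e i)
  map_add' v w := by ext; simp; ring
  map_smul' c v := by ext; simp; ring

/-- The stabilized form as a bilinear map. -/
def formB (lam mu : ℝ) : WeakSpace 𝒯 k →ₗ[ℝ] Module.Dual ℝ (WeakSpace 𝒯 k) :=
  mu • ∑ T : 𝒯.Cell, (matrixForm (k - 1) T.1).compl₁₂ (weakGradL T) (weakGradL T) +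
  (lam + mu) • ∑ T : 𝒯.Cell, (polyForm k T.1).compl₁₂ (weakDivL T) (weakDivL T) +
  ∑ T : 𝒯.Cell, (diamT T.1)⁻¹ • ∑ e ∈ 𝒯.sides T, (sideForm e.1).compl₁₂ (jump T e) (jump T e)

lemma formB_apply (lam mu : ℝ) (w v : WeakSpace 𝒯 k) : formB lam mu w v =
    mu * ∑ T : 𝒯.Cell, matrixForm (k - 1) T.1 (weakGradL T w) (weakGradL T v) +
    (lam + mu) * ∑ T : 𝒯.Cell, polyForm k T.1 (weakDivL T w) (weakDivL T v) +
    ∑ T : 𝒯.Cell, (diamT T.1)⁻¹ * ∑ e ∈ 𝒯.sides T, sideForm e.1 (jump T e w) (jump T e v) := by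
  simp [formB, LinearMap.sum_apply]

lemma formAs_eq (lam mu : ℝ) (w v : WeakSpace 𝒯 k) : formAs lam mu w v = formB lam mu w v := by
  rw [formB_apply, formAs, formA, stab]
  simp only [weakGrad_eq, weakDiv_eq, matrixForm_apply, polyForm_apply, sideForm_apply,
    cellInt_apply, surfInt_apply]
  simp [jump]

/-- All three parts of the form are nonnegative, so the gradient and stabilizer parts vanish
separately. Then `v₀` is cellwise constant with trace `v_b`, hence continuous across faces and zero
at the boundary. -/
lemma formB_definite (hΩ : IsOpen Ω) {lam mu : ℝ} (hlam : 0 < lam) (hmu : 0 < mu)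
    {v : WeakSpace 𝒯 k} (hv : MemV0 v) (h0 : formB lam mu v v = 0) : v = 0 := by
  have hd := NeZero.pos d
  have n1 : ∀ T : 𝒯.Cell, 0 ≤ matrixForm (k - 1) T.1 (weakGradL T v) (weakGradL T v) :=
    fun T => matrixForm_nonneg _ _ _
  have n2 : ∀ T : 𝒯.Cell, 0 ≤ polyForm k T.1 (weakDivL T v) (weakDivL T v) :=
    fun T => cellInt_mul_self_nonneg _ _
  have n3 : ∀ T : 𝒯.Cell, 0 ≤ (diamT T.1)⁻¹ * ∑ e ∈ 𝒯.sides T,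
      sideForm e.1 (jump T e v) (jump T e v) := fun T =>
    mul_nonneg (inv_nonneg.2 (diamT_pos hd T).le) (Finset.sum_nonneg fun e _ => sideForm_nonneg _ _)
  have m1 := Finset.sum_nonneg fun T (_ : T ∈ Finset.univ) => n1 T
  have m2 := mul_nonneg (add_pos hlam hmu).le (Finset.sum_nonneg fun T (_ : T ∈ Finset.univ) => n2 T)
  have m3 := Finset.sum_nonneg fun T (_ : T ∈ Finset.univ) => n3 T
  rw [formB_apply] at h0
  have z1 := mul_nonneg hmu.le m1
  have hG : ∀ T : 𝒯.Cell, weakGradL T v = 0 := fun T => by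
    have s1 : ∑ T : 𝒯.Cell, matrixForm (k - 1) T.1 (weakGradL T v) (weakGradL T v) = 0 := by
      have : mu * ∑ T : 𝒯.Cell, matrixForm (k - 1) T.1 (weakGradL T v) (weakGradL T v) = 0 := by
        linarith
      exact (mul_eq_zero.1 this).resolve_left hmu.ne'
    exact (isSimplex T).matrixForm_definite _ _
      ((Finset.sum_eq_zero_iff_of_nonneg fun T _ => n1 T).1 s1 T (Finset.mem_univ T))
  have hJ : ∀ T : 𝒯.Cell, ∀ e ∈ 𝒯.sides T, ∀ i,
      polyC e.1 (v.1 T i).1 = facePolyC k e.1 (v.2 e i) := fun T e he i => by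
    have s3 := (Finset.sum_eq_zero_iff_of_nonneg fun T _ => n3 T).1
      (le_antisymm (by linarith) m3) T (Finset.mem_univ T)
    have s4 := (mul_eq_zero.1 s3).resolve_left (inv_ne_zero (diamT_pos hd T).ne')
    have s5 := (Finset.sum_eq_zero_iff_of_nonneg fun e _ => sideForm_nonneg _ _).1 s4 e he
    exact sub_eq_zero.1 (sideForm_definite s5 i)
  have hC : ∀ (T : 𝒯.Cell) i, (v.1 T i).1 = MvPolynomial.C (pval (v.1 T i).1 0) := fun T i =>
    eq_C_of_pderiv_eq_zero fun j => pderiv_eq_zero_of_weakGrad (hG T) (hJ T) i j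
  have hpt : ∀ e : 𝒯.Face, Nonempty (hull e.1) := fun e =>
    (convexHull_nonempty_iff.2
      (Finset.coe_nonempty.2 (𝒯.toSimplicialComplex.nonempty_of_mem_faces e.2.1))).to_subtype
  have hval : ∀ (T : 𝒯.Cell), ∀ e ∈ 𝒯.sides T, ∀ i (x : hull e.1),
      pval (v.1 T i).1 0 = (v.2 e i).1 x := fun T e he i x => by
    have := DFunLike.congr_fun (hJ T e he i) x
    rw [hC T i, polyC_apply, pval_C] at this
    exact this
  have hz : ∀ (T : 𝒯.Cell) i, pval (v.1 T i).1 0 = 0 := fun T i => by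
    refine cellConst_eq_zero hΩ (fun T => pval (v.1 T i).1 0) (fun T e he hb => ?_)
      (fun T₁ T₂ e h1 h2 => ?_) T
    · obtain ⟨x⟩ := hpt e
      rw [hval T e he i x, hv e hb]
      rfl
    · obtain ⟨x⟩ := hpt e
      exact (hval T₁ e h1 i x).trans (hval T₂ e h2 i x).symm
  refine Prod.ext (funext fun T => funext fun i => Subtype.ext ?_)
    (funext fun e => funext fun i => Subtype.ext (funext fun x => ?_))
  · rw [hC T i, hz T i, map_zero]; rfl
  · obtain ⟨T, hT⟩ := exists_cell_of_face e
    rw [← hval T e hT i x, hz T i]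
    rfl

end WG

namespace WG

variable {d : ℕ} {Ω : Set (Pt d)} {𝒯 : SimplicialPartition Ω} {k : ℕ}

open SimplicialPartition

/-! ### The projection on the boundary -/

lemma map_val_surf (e : Finset (Pt d)) : Measure.map Subtype.val (surf e) =
    (Measure.euclideanHausdorffMeasure (d - 1)).restrict (hull e) := by
  rw [surf, isometry_subtype_coe.map_euclideanHausdorffMeasure, Subtype.range_coe]

/-- The measure on a boundary face is a restriction of the surface measure on `Γ`, so square
integrability of the datum passes to each such face. -/
lemma memLp_comp_val {g : Pt d → Pt d}
    (hg : MemLp g 2 ((Measure.euclideanHausdorffMeasure (d - 1)).restrict (frontier Ω)))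
    {e : Finset (Pt d)} (he : OnBoundary Ω e) : MemLp (fun x : hull e => g x) 2 (surf e) := by
  refine MemLp.comp_measurePreserving (ν := (Measure.euclideanHausdorffMeasure (d - 1)).restrict
    (hull e)) ?_ ⟨measurable_subtype_coe, map_val_surf e⟩
  exact hg.mono_measure (Measure.restrict_mono he le_rfl)

lemma integrable_apply_mul {e : Finset (Pt d)} [IsFiniteMeasure (surf e)] {g : Pt d → Pt d}
    (hg : MemLp (fun x : hull e => g x) 2 (surf e)) (i : Fin d) (φ : C(hull e, ℝ)) :
    Integrable (fun x : hull e => g x i * φ x) (surf e) := by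
  have h1 : Integrable (fun x : hull e => g x i) (surf e) :=
    (EuclideanSpace.proj (𝕜 := ℝ) i).integrable_comp (hg.integrable (by norm_num))
  exact h1.mul_bdd (c := ‖φ‖) φ.continuous.aestronglyMeasurable
    (Filter.Eventually.of_forall fun x => φ.norm_coe_le_norm x)

/-- The functional `q ↦ ⟨g, q⟩_e`. -/
def boundaryFunctional {e : Finset (Pt d)} [IsFiniteMeasure (surf e)] {g : Pt d → Pt d}
    (hg : MemLp (fun x : hull e => g x) 2 (surf e)) : Module.Dual ℝ (Fin d → FacePoly k e) where
  toFun q := ∑ i, ∫ x : hull e, g x i * facePolyC k e (q i) x ∂(surf e)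
  map_add' p q := by
    rw [← Finset.sum_add_distrib]
    refine Finset.sum_congr rfl fun i _ => ?_
    rw [← integral_add (integrable_apply_mul hg i _) (integrable_apply_mul hg i _)]
    simp [mul_add]
  map_smul' c q := by
    rw [RingHom.id_apply, smul_eq_mul, Finset.mul_sum]
    refine Finset.sum_congr rfl fun i _ => ?_
    rw [← integral_const_mul]
    simp [mul_left_comm]

/-- The `L²(e)` inner product on `[P_k(e)]^d`. -/
def facePolyForm (k : ℕ) (e : Finset (Pt d)) [IsFiniteMeasure (surf e)] :
    (Fin d → FacePoly k e) →ₗ[ℝ] Module.Dual ℝ (Fin d → FacePoly k e) :=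
  (sideForm e).compl₁₂ (LinearMap.pi fun i => facePolyC k e ∘ₗ LinearMap.proj i)
    (LinearMap.pi fun i => facePolyC k e ∘ₗ LinearMap.proj i)

lemma facePolyForm_definite {e : Finset (Pt d)} [IsFiniteMeasure (surf e)]
    [(surf e).IsOpenPosMeasure] (p : Fin d → FacePoly k e) (h0 : facePolyForm k e p p = 0) :
    p = 0 :=
  funext fun i => facePolyC_injective k e ((sideForm_definite h0 i).trans (map_zero _).symm)

lemma isQb_iff {e : Finset (Pt d)} [IsFiniteMeasure (surf e)] {g : Pt d → Pt d}
    (hg : MemLp (fun x : hull e => g x) 2 (surf e)) {p : Fin d → FacePoly k e} :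
    IsQb g p ↔ ∀ q, facePolyForm k e p q = boundaryFunctional hg q := by
  refine forall_congr' fun q => ?_
  have h1 : facePolyForm k e p q = ∫ x : hull e, ∑ i, (p i).1 x * (q i).1 x ∂(surf e) := by
    simp [facePolyForm, sideForm_apply, -map_sum, surfInt_apply]
  have h2 : boundaryFunctional hg q = ∫ x : hull e, ∑ i, g x i * (q i).1 x ∂(surf e) :=
    (integral_finsetSum Finset.univ fun i _ =>
      integrable_apply_mul hg i (facePolyC k e (q i))).symm
  rw [h1, h2]

lemma existsUnique_isQb {e : Finset (Pt d)} [IsFiniteMeasure (surf e)]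
    [(surf e).IsOpenPosMeasure] {g : Pt d → Pt d}
    (hg : MemLp (fun x : hull e => g x) 2 (surf e)) :
    ∃! p : Fin d → FacePoly k e, IsQb g p := by
  have h : ∀ p : Fin d → FacePoly k e, IsQb g p ↔
      p = (rieszEquiv (facePolyForm k e) facePolyForm_definite).symm (boundaryFunctional hg) :=
    fun p => (isQb_iff hg).trans eq_rieszEquiv_symm.symm
  exact ⟨_, (h _).2 rfl, fun p hp => (h p).1 hp⟩

/-! ### Well-posedness of the scheme -/

lemma integrable_inner_toFun {f : Pt d → Pt d} (hf : MemLp f 2 (volume.restrict Ω))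
    (r : BrokenRT 𝒯 k) : Integrable (fun x => ⟪f x, r.toFun x⟫) (volume.restrict Ω) := by
  have hr := (memLp_toFun r).restrict Ω
  refine (L2.integrable_inner (𝕜 := ℝ) (hf.toLp f) (hr.toLp _)).congr ?_
  filter_upwards [hf.coeFn_toLp, hr.coeFn_toLp] with x h1 h2
  rw [h1, h2]

/-- The functional `r ↦ (f, r)`. -/
def loadFunctional {f : Pt d → Pt d} (hf : MemLp f 2 (volume.restrict Ω)) :
    Module.Dual ℝ (BrokenRT 𝒯 k) where
  toFun r := ∫ x in Ω, ⟪f x, r.toFun x⟫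
  map_add' r s := by
    rw [← integral_add (integrable_inner_toFun hf r) (integrable_inner_toFun hf s)]
    simp only [toFun_add, inner_add_right]
  map_smul' c r := by
    rw [RingHom.id_apply, smul_eq_mul, ← integral_const_mul]
    simp only [toFun_smul, inner_smul_right]

variable (𝒯 k) in
/-- The subspace `V_h⁰`. -/
def zeroTrace : Submodule ℝ (WeakSpace 𝒯 k) where
  carrier := {v | MemV0 v}
  zero_mem' _ _ := rfl
  add_mem' hv hw e he := by
    rw [Prod.snd_add, Pi.add_apply, hv e he, hw e he, add_zero]
  smul_mem' c v hv e he := by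
    rw [Prod.smul_snd, Pi.smul_apply, hv e he, smul_zero]

/-- A variational problem whose form is definite on a subspace `W` has exactly one solution in
each coset of `W`. -/
lemma existsUnique_sub_mem {V : Type*} [AddCommGroup V] [Module ℝ V] [FiniteDimensional ℝ V]
    (W : Submodule ℝ V) {B : V →ₗ[ℝ] Module.Dual ℝ V} (hB : ∀ v ∈ W, B v v = 0 → v = 0)
    (L : Module.Dual ℝ V) (w : V) :
    ∃! u : V, u - w ∈ W ∧ ∀ v ∈ W, B u v = L v := by
  let B₀ : W →ₗ[ℝ] Module.Dual ℝ W := B.compl₁₂ W.subtype W.subtype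
  have hB₀ : ∀ v, B₀ v v = 0 → v = 0 := fun v h => Subtype.ext (hB v.1 v.2 h)
  -- Writing `u = u₀ + w` with `u₀ ∈ W` moves the known part `B w` into the load.
  let L₀ : Module.Dual ℝ W := (L - B w).domRestrict W
  obtain ⟨u₀, hu₀⟩ : ∃ u₀ : W, ∀ u : W, u = u₀ ↔ ∀ v : W, B u.1 v.1 = L v.1 - B w v.1 :=
    ⟨(rieszEquiv B₀ hB₀).symm L₀, fun u => eq_rieszEquiv_symm⟩
  refine ⟨u₀.1 + w, ⟨by simp, fun v hv => ?_⟩, fun u hu => ?_⟩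
  · have := (hu₀ u₀).1 rfl ⟨v, hv⟩
    rw [map_add, LinearMap.add_apply]
    exact eq_sub_iff_add_eq.1 this
  · have h1 : (⟨u - w, hu.1⟩ : W) = u₀ := (hu₀ _).2 fun v => by
      rw [map_sub, LinearMap.sub_apply, hu.2 v.1 v.2]
    rw [← h1, sub_add_cancel]

end WG

end

/-- The weak gradient, the weak divergence and the reconstruction are well defined, and the
scheme has exactly one solution. -/
theorem theorem2p1 {d : ℕ} (hd : d = 2 ∨ d = 3) (Ω : Set (WG.Pt d))
    (hΩo : IsOpen Ω) (hΩb : Bornology.IsBounded Ω) (hΩc : IsConnected Ω)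
    (hΩL : WG.HasLipschitzBoundary Ω)
    (𝒯 : WG.SimplicialPartition Ω) (k : ℕ) (hk : 1 ≤ k)
    (lam mu : ℝ) (hlam : 0 < lam) (hmu : 0 < mu)
    (f : WG.Pt d → WG.Pt d) (hf : MemLp f 2 (volume.restrict Ω))
    (g : WG.Pt d → WG.Pt d)
    (hg : MemLp g 2 ((Measure.euclideanHausdorffMeasure (d - 1)).restrict (frontier Ω))) :
    (∀ (v : WG.WeakSpace 𝒯 k) (T : 𝒯.Cell), ∃! G, WG.IsWeakGrad v T G) ∧
    (∀ (v : WG.WeakSpace 𝒯 k) (T : 𝒯.Cell), ∃! D, WG.IsWeakDiv v T D) ∧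
    (∀ v : WG.WeakSpace 𝒯 k, ∃! r, WG.IsReconstruction v r) ∧
    ∃! u : WG.WeakSpace 𝒯 k, WG.IsSolution lam mu f g u := by
  have : NeZero d := ⟨by omega⟩
  refine ⟨fun v T => ⟨_, WG.isWeakGrad_iff_eq.2 rfl, fun _ h => WG.isWeakGrad_iff_eq.1 h⟩,
    fun v T => ⟨_, WG.isWeakDiv_iff_eq.2 rfl, fun _ h => WG.isWeakDiv_iff_eq.1 h⟩,
    fun v => ⟨_, (WG.isReconstruction_iff_eq hΩo hk).2 rfl,
      fun _ h => (WG.isReconstruction_iff_eq hΩo hk).1 h⟩, ?_⟩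
  -- `p` is a lift of the boundary data: `Q_b g` on faces in `Γ`, and zero on the others, where its
  -- value does not matter. The boundary condition then says that `u - (0, p)` is in `V_h⁰`.
  have hQ : ∀ e : 𝒯.Face, ∃ p : Fin d → WG.FacePoly k e.1, WG.OnBoundary Ω e.1 →
      ∀ q, WG.IsQb g q ↔ q = p := by
    intro e
    by_cases he : WG.OnBoundary Ω e.1
    · obtain ⟨p, hp, hu⟩ := WG.existsUnique_isQb (k := k) (WG.memLp_comp_val hg he)
      exact ⟨p, fun _ q => ⟨hu q, fun h => h ▸ hp⟩⟩
    · exact ⟨0, fun h => absurd h he⟩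
  choose p hp using hQ
  refine (existsUnique_congr fun u => ?_).1 (WG.existsUnique_sub_mem (WG.zeroTrace 𝒯 k)
    (fun v hv h => WG.formB_definite hΩo hlam hmu hv h)
    (WG.loadFunctional hf ∘ₗ WG.reconL hk) (0, p))
  have h1 : WG.MemV0 (u - (0, p)) ↔ ∀ e : 𝒯.Face, WG.OnBoundary Ω e.1 → WG.IsQb g (u.2 e) :=
    forall_congr' fun e => forall_congr' fun he => by rw [hp e he]; exact sub_eq_zero
  have h2 : ∀ v, WG.formAs lam mu u v = (∫ x in Ω, ⟪f x, (WG.reconstruct v).toFun x⟫) ↔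
      WG.formB lam mu u v = (WG.loadFunctional hf ∘ₗ WG.reconL hk) v := fun v => by
    rw [WG.formAs_eq, WG.reconstruct_eq hΩo hk]; rfl
  exact ⟨fun h => ⟨h1.1 h.1, fun v hv => (h2 v).2 (h.2 v hv)⟩,
    fun h => ⟨h1.2 h.boundary, fun v hv => (h2 v).1 (h.equation v hv)⟩⟩
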